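/- **Setting.** Let $d\ge 3$ and $T\ge 1$ be integers, $K\subseteq\mathbb R^d$ closed and convex, $r:\mathbb R^d\to\mathbb R$ convex, and $l(x)=\mathbb E_{\xi}[l(x;\xi)]$ (with $l(x;\cdot)$ integrable), $f=l+r$. Write $\phi(x)=\sum_{i=1}^d\big((|x_i|+\tfrac1d)\ln(d|x_i|+1)-|x_i|\big)$ and, for a differentiable $\psi$, let $B_\psi(y,x)=\psi(y)-\psi(x)-\langle\nabla\psi(x),y-x\rangle$, $$\mathcal P^{\psi}_K(x,g,\eta)=\arg\min_{y\in K}\{\langle g,y\rangle+r(y)+\eta B_\psi(y,x)\},\qquad \mathcal G^{\psi}_K(x,g,\eta)=\eta\,(x-\mathcal P^{\psi}_K(x,g,\eta)).$$ Let $L,D,R>0$ and $G,\sigma$ be constants such that: (1) for every realisation $\xi$, $l(\cdot;\xi)$ is differentiable, $G$-Lipschitz and has $L$-Lipschitz gradient with respect to $\|\cdot\|_2$; (2) $\mathbb E_\xi[\nabla l(x;\xi)]=\nabla l(x)$ for all $x\in\mathbb R^d$, and $\mathbb E_\xi\|\nabla l(x)-\nabla l(x;\xi)\|_2^2\le\sigma^2$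 for all $x\in K$; (3) $\|\mathcal P^{\phi}_K(x,g,\eta)\|_1\le D$ for all $\eta>0$, $x\in K$, $g\in\mathbb R^d$; (4) $f(x)\in[0,R]$ for all $x\in K$. **Algorithm (ZO-AdaExpGrad).** Let $m=\lceil 2Te(2\ln d-1)\rceil$, $\nu=\frac1{d\sqrt T}$, $x_1\in K$. For $t=1,\dots,T$ draw independent vectors $u_{t,1},\dots,u_{t,m}\in\{-1,1\}^d$ with i.i.d. Rademacher coordinates and i.i.d. realisations $\xi_{t,1},\dots,\xi_{t,m}$ of $\xi$ (all samples being mutually independent), and set $$d_t=\frac1{m\nu}\sum_{j=1}^m\big(l(x_t+\nu u_{t,j};\xi_{t,j})-l(x_t;\xi_{t,j})\big)u_{t,j},\qquad x_{t+1}=\mathcal P^{\phi}_K(x_t,d_t,\eta_t).$$ Let $\tau$ be uniform on $\{1,\dots,T\}$, independent of the samples. Each evaluation of $l(\cdot;\cdot)$ is one oracle call. Since $(D+1)\phi$ is $1$-strongly convex with respect to $\|\cdot\|_1$ on the $\ell_1$-ball of radius $D$, and the update equals the mirror step with $(D+1)\phi$ and stepsize $\eta_t/(D+1)$, stationarity at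 the output is measured by $$\mathcal G_\tau=\mathcal G_K^{(D+1)\phi}\Big(x_\tau,\nabla l(x_\tau),\frac{\eta_\tau}{D+1}\Big)=\frac{\eta_\tau}{D+1}\big(x_\tau-\mathcal P_K^{\phi}(x_\tau,\nabla l(x_\tau),\eta_\tau)\big).$$ **Theorem.** Let $V=10G^2+8\sigma^2+2L^2$ and $C=33R^2+192L^2D(D+1)$. (a) With constant stepsizes $\eta_t=2L(D+1)$, $$\mathbb E\|\mathcal G_\tau\|_1^2\le\sqrt{\frac{2e(2\ln d-1)}{mT}}\,(6V+8LR).$$ (b) Suppose in addition $D\ge1$ and $R^2\ge\frac12$. With adaptive stepsizes $\eta_t=\alpha_t$, where $$\lambda_t=\frac1{\max\{\|x_t\|_1,\|x_{t+1}\|_1\}+1},\qquad \alpha_t=\Big(\sum_{s=1}^{t-1}\lambda_s^2\alpha_s^2\|x_{s+1}-x_s\|_1^2+1\Big)^{1/2},$$ $$\mathbb E\|\mathcal G_\tau\|_1^2\le\sqrt{\frac{2e(2\ln d-1)}{mT}}\,(13V+C).$$ (c) Let $B=6V+8LR$ in case (a) and $B=13V+C$ in case (b). For every $\varepsilon\in(0,1]$,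 the choice $T=\lceil B/\varepsilon^2\rceil$ gives $\mathbb E\|\mathcal G_\tau\|_1^2\le\varepsilon^2$, and the total number of oracle calls is at most $8e(B+1)^2\,\frac{\ln d}{\varepsilon^4}$, that is, $\mathcal O(\ln d/\varepsilon^4)$ with a constant depending only on $G,L,\sigma,R,D$. -/

import Mathlib

open MeasureTheory ProbabilityTheory

noncomputable section

namespace ZOAdaExp

/-- The `ℓ₁` norm on `ℝ^d`. -/
def l1Norm {d : ℕ} (x : EuclideanSpace ℝ (Fin d)) : ℝ := ∑ i, |x i|

/-- The entropy-like function
`φ(x) = ∑ᵢ ((|xᵢ| + 1/d) ln (d |xᵢ| + 1) - |xᵢ|)`. -/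
def entropyLike {d : ℕ} (x : EuclideanSpace ℝ (Fin d)) : ℝ :=
  ∑ i, ((|x i| + 1 / (d : ℝ)) * Real.log ((d : ℝ) * |x i| + 1) - |x i|)

/-- The Bregman divergence `B_φ(y, x)`. -/
def bregman {d : ℕ} (φ : EuclideanSpace ℝ (Fin d) → ℝ) (y x : EuclideanSpace ℝ (Fin d)) : ℝ :=
  φ y - φ x - inner ℝ (gradient φ x) (y - x)

/-- The objective of a composite mirror step at `x` with direction `g` and stepsize `η`:
`y ↦ ⟨g, y⟩ + r(y) + η B_φ(y, x)`. -/
def mirrorObjective {d : ℕ} (φ r : EuclideanSpace ℝ (Fin d) → ℝ)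
    (x g : EuclideanSpace ℝ (Fin d)) (η : ℝ) (y : EuclideanSpace ℝ (Fin d)) : ℝ :=
  inner ℝ g y + r y + η * bregman φ y x

/-- `y` is a minimiser over `K` of the objective of the mirror step. -/
def IsMirrorMin {d : ℕ} (φ r : EuclideanSpace ℝ (Fin d) → ℝ) (K : Set (EuclideanSpace ℝ (Fin d)))
    (x g : EuclideanSpace ℝ (Fin d)) (η : ℝ) (y : EuclideanSpace ℝ (Fin d)) : Prop :=
  y ∈ K ∧ IsMinOn (mirrorObjective φ r x g η) K y

open Classical in
/-- The generalised projection `P_K(x, g, η) = argmin_{y ∈ K} ⟨g, y⟩ + r(y) + η B_φ(y, x)`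
(with a junk value when there is no minimiser). -/
def genProj {d : ℕ} (φ r : EuclideanSpace ℝ (Fin d) → ℝ) (K : Set (EuclideanSpace ℝ (Fin d)))
    (x g : EuclideanSpace ℝ (Fin d)) (η : ℝ) : EuclideanSpace ℝ (Fin d) :=
  if h : ∃ y, IsMirrorMin φ r K x g η y then h.choose else x

/-- The generalised gradient map `G_K(x, g, η) = η (x - P_K(x, g, η))`. -/
def gradMap {d : ℕ} (φ r : EuclideanSpace ℝ (Fin d) → ℝ) (K : Set (EuclideanSpace ℝ (Fin d)))
    (x g : EuclideanSpace ℝ (Fin d)) (η : ℝ) : EuclideanSpace ℝ (Fin d) :=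
  η • (x - genProj φ r K x g η)

/-- The expected loss `l(x) = E_ξ[l(x; ξ)]`. -/
def meanLoss {d : ℕ} {Ξ : Type*} [MeasurableSpace Ξ] (l : EuclideanSpace ℝ (Fin d) → Ξ → ℝ)
    (μ : Measure Ξ) (x : EuclideanSpace ℝ (Fin d)) : ℝ :=
  ∫ ξ, l x ξ ∂μ

/-- Every realisation `l(·; ξ)` is `G`-Lipschitz and differentiable with `L`-Lipschitz gradient,
with respect to the Euclidean norm. -/
structure SmoothLoss {d : ℕ} {Ξ : Type*} (l : EuclideanSpace ℝ (Fin d) → Ξ → ℝ)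
    (G L : ℝ) : Prop where
  differentiable : ∀ ξ, Differentiable ℝ (fun x => l x ξ)
  lipschitz : ∀ ξ x y, |l x ξ - l y ξ| ≤ G * ‖x - y‖
  smooth : ∀ ξ x y,
    ‖gradient (fun z => l z ξ) x - gradient (fun z => l z ξ) y‖ ≤ L * ‖x - y‖

/-- The expected loss is well defined, and stochastic gradients are unbiased:
`E_ξ[∇l(x; ξ)] = ∇l(x)` for all `x`. -/
structure UnbiasedGradient {d : ℕ} {Ξ : Type*} [MeasurableSpace Ξ]
    (l : EuclideanSpace ℝ (Fin d) → Ξ → ℝ) (μ : Measure Ξ) : Prop where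
  measurable : ∀ x, Measurable (l x)
  integrable : ∀ x, Integrable (l x) μ
  unbiased : ∀ x, HasGradientAt (meanLoss l μ) (∫ ξ, gradient (fun z => l z ξ) x ∂μ) x

/-- The Rademacher distribution: `±1` with probability `1/2` each. -/
def rademacher : Measure ℝ :=
  (2⁻¹ : ENNReal) • Measure.dirac (1 : ℝ) + (2⁻¹ : ENNReal) • Measure.dirac (-1 : ℝ)

/-- The points at which the zeroth-order oracle `(x, ξ) ↦ l(x; ξ)` is queried in one iteration,
given the mini-batch `s j = (u_j, ξ_j)`. -/
def queries {d m : ℕ} {Ξ : Type*} (ν : ℝ) (x : EuclideanSpace ℝ (Fin d))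
    (s : Fin m → (Fin d → ℝ) × Ξ) : List (EuclideanSpace ℝ (Fin d) × Ξ) :=
  (List.finRange m).flatMap fun j =>
    [(x + ν • WithLp.toLp 2 (s j).1, (s j).2), (x, (s j).2)]

/-- The mini-batch two-point estimator
`(1 / (m ν)) ∑ⱼ (l(x + ν uⱼ; ξⱼ) - l(x; ξⱼ)) uⱼ`, where `s j = (u_j, ξ_j)`. -/
def batchGradient {d m : ℕ} {Ξ : Type*} (l : EuclideanSpace ℝ (Fin d) → Ξ → ℝ) (ν : ℝ)
    (x : EuclideanSpace ℝ (Fin d)) (s : Fin m → (Fin d → ℝ) × Ξ) : EuclideanSpace ℝ (Fin d) :=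
  (1 / ((m : ℝ) * ν)) •
    ∑ j, (l (x + ν • WithLp.toLp 2 (s j).1) (s j).2 - l x (s j).2) • WithLp.toLp 2 (s j).1

/-- The randomness of the algorithm: the samples `S t j = (u_{t,j}, ξ_{t,j})` are independent, the
coordinates of `u_{t,j}` are independent Rademacher variables, independent of `ξ_{t,j} ∼ μ`, and
the output index `τ` is uniform and independent of all samples.
Iterations are numbered `0, …, T - 1`. -/
structure IsSampling {d T m : ℕ} {Ω Ξ : Type*} [MeasurableSpace Ω] [MeasurableSpace Ξ]
    (P : Measure Ω) (μ : Measure Ξ) (S : Fin T → Fin m → Ω → (Fin d → ℝ) × Ξ)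
    (τ : Ω → Fin T) : Prop where
  measurable : ∀ t j, Measurable (S t j)
  law : ∀ t j, P.map (S t j) = (Measure.pi fun _ : Fin d => rademacher).prod μ
  indep : iIndepFun (fun p : Fin T × Fin m => S p.1 p.2) P
  index_measurable : Measurable τ
  index_law : ∀ t, P (τ ⁻¹' {t}) = (T : ENNReal)⁻¹
  index_indep : IndepFun τ (fun ω (p : Fin T × Fin m) => S p.1 p.2 ω) P

/-- `x` is the sequence of iterates of ZO-AdaExpGrad with smoothing parameter `ν`, stepsizes `η`,
and samples `S`, started at `x₁` (stored as `x 0`). -/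
structure IsRun {d T m : ℕ} {Ω Ξ : Type*} (l : EuclideanSpace ℝ (Fin d) → Ξ → ℝ)
    (r : EuclideanSpace ℝ (Fin d) → ℝ) (K : Set (EuclideanSpace ℝ (Fin d))) (ν : ℝ)
    (S : Fin T → Fin m → Ω → (Fin d → ℝ) × Ξ) (η : ℕ → Ω → ℝ)
    (x₁ : EuclideanSpace ℝ (Fin d)) (x : ℕ → Ω → EuclideanSpace ℝ (Fin d)) : Prop where
  init : ∀ ω, x 0 ω = x₁
  step : ∀ (t : Fin T) (ω : Ω), x (t + 1) ω =
    genProj entropyLike r K (x t ω) (batchGradient l ν (x t ω) fun j => S t j ω) (η t ω)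

/-- The number of zeroth-order oracle calls made during a run. -/
def oracleCalls {d T m : ℕ} {Ω Ξ : Type*} (ν : ℝ)
    (S : Fin T → Fin m → Ω → (Fin d → ℝ) × Ξ) (x : ℕ → Ω → EuclideanSpace ℝ (Fin d))
    (ω : Ω) : ℕ :=
  ∑ t : Fin T, (queries ν (x t ω) fun j => S t j ω).length

/-- The weight `λ_t = 1 / (max {‖x_t‖₁, ‖x_{t+1}‖₁} + 1)`. -/
def adaptiveWeight {d : ℕ} (x : ℕ → EuclideanSpace ℝ (Fin d)) (t : ℕ) : ℝ :=
  1 / (max (l1Norm (x t)) (l1Norm (x (t + 1))) + 1)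

/-- The adaptive stepsize `α_t = (∑_{s < t} λ_s² α_s² ‖x_{s+1} - x_s‖₁² + 1)^{1/2}`. -/
def adaptiveStep {d : ℕ} (x : ℕ → EuclideanSpace ℝ (Fin d)) (t : ℕ) : ℝ :=
  Real.sqrt (∑ s : Fin t,
    adaptiveWeight x s ^ 2 * adaptiveStep x s ^ 2 * l1Norm (x (s + 1) - x s) ^ 2 + 1)
termination_by t
decreasing_by exact s.isLt

/-- The squared `ℓ₁` norm of the generalised gradient map at the output `x_τ`, for the stepsizes
`η`. The map is that of the distance-generating function `(D + 1) φ`, which is `1`-strongly convex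
on the `ℓ₁` ball of radius `D`; a mirror step with `φ` and stepsize `η` is the same as a mirror step
with `(D + 1) φ` and stepsize `η / (D + 1)`. -/
def stationarity {d T : ℕ} {Ω Ξ : Type*} [MeasurableSpace Ξ]
    (l : EuclideanSpace ℝ (Fin d) → Ξ → ℝ) (μ : Measure Ξ)
    (r : EuclideanSpace ℝ (Fin d) → ℝ) (K : Set (EuclideanSpace ℝ (Fin d))) (D : ℝ)
    (η : ℕ → Ω → ℝ) (x : ℕ → Ω → EuclideanSpace ℝ (Fin d)) (τ : Ω → Fin T) (ω : Ω) : ℝ :=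
  l1Norm (gradMap (fun y => (D + 1) * entropyLike y) r K (x (τ ω) ω)
    (gradient (meanLoss l μ) (x (τ ω) ω)) (η (τ ω) ω / (D + 1))) ^ 2

end ZOAdaExp

end

/-!
Why the bounds hold.

The whole analysis of the mirror steps rests on one property of `φ`, its gradient being strongly
monotone in the `ℓ₁` norm with modulus `1 / (D + 1)` on the `ℓ₁` ball of radius `D`
(`l1Norm_sq_div_le_inner_entropyGrad`), together with the variational inequality that characterises
a mirror step (`IsMirrorMin.variational`). They give the decrease of the objective in a step with an
inexact gradient (`IsMirrorMin.descent`), the Lipschitz dependence of the step on the gradient from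
`ℓ_∞` to `ℓ₁` (`l1Norm_smul_sub_le`), and the continuity of the step in all its parameters, hence
the measurability of the iterates. The bound on the mirror steps forces `K` itself into the ball of
radius `D` (`l1Norm_le_of_genProj`); so `K` is compact and all mirror steps exist.

The dimension enters only through the logarithm, because the gradient error is measured in `ℓ_∞`.
For a single sample the linear part of the two-point estimator is `⟨v, u⟩ u` with `v` the stochastic
gradient. Its centred coordinates are sub-Gaussian with variance proxy `2G²`
(`integral_exp_linearNoise_le`), so the maximum over the `d` coordinates of the average of `m`
of them has second moment of order `G² ln d / m`; the remainder is at most `L ν d / 2`. This is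
`lintegral_supNorm_batchGradient_sub_sq_le`. The choice of `m` and `ν` makes the total at most
`κ (4G² + 9L²/16)` with `κ = √(2e(2 ln d - 1) / (mT))`.

Along every trajectory the squared gradient maps sum to a constant plus a multiple of the squared
errors. With the constant stepsize the descent inequalities telescope
(`IsRun.sum_iterateStationarity_le_of_const`). With the adaptive stepsizes each is multiplied by
its stepsize first, and the sum of the squared steps is bounded in terms of its own square root
(`sum_sq_le_of_adaptive_descent`); as this is pathwise, the dependence of the stepsizes on the
samples does no harm. Taking expectations requires independence only in freezing the iterate in the
error bound (`IsSampling.integral_supNorm_error_le`) and in averaging over the output index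
(`IsSampling.integral_index`). Finally `κ` agrees with `1 / T` up to a factor `9 / 8`
(`batchSize_bounds`), which the slack in the constants absorbs.
-/

noncomputable section

namespace ZOAdaExp

/-! ### Strong monotonicity of the gradient of the entropy-like function -/

/-- The derivative `t ↦ sgn(t) ln(c |t| + 1)` of `t ↦ (|t| + 1/c) ln(c |t| + 1) - |t|`, written
with positive and negative parts so that its continuity is visible. -/
def entropySlope (c t : ℝ) : ℝ := Real.log (c * max t 0 + 1) - Real.log (c * max (-t) 0 + 1)

lemma entropySlope_of_nonneg {c t : ℝ} (ht : 0 ≤ t) :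
    entropySlope c t = Real.log (c * t + 1) := by
  simp [entropySlope, ht]

lemma entropySlope_neg (c t : ℝ) : entropySlope c (-t) = -entropySlope c t := by
  simp [entropySlope]

lemma continuous_entropySlope {c : ℝ} (hc : 0 < c) : Continuous (entropySlope c) := by
  unfold entropySlope
  refine Continuous.sub (Continuous.log (by fun_prop) fun t => ?_)
    (Continuous.log (by fun_prop) fun t => ?_) <;> positivity

/-- The logarithmic mean of two positive numbers is at most their arithmetic mean. -/
lemma two_mul_sub_le_log_sub_mul_add {p q : ℝ} (hq : 0 < q) (hqp : q ≤ p) :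
    2 * (p - q) ≤ (Real.log p - Real.log q) * (p + q) := by
  have hp : 0 < p := hq.trans_le hqp
  have h := Real.le_log_one_add_of_nonneg (x := p / q - 1) (by
    rw [sub_nonneg, le_div_iff₀ hq]; linarith)
  rw [add_sub_cancel, Real.log_div hp.ne' hq.ne'] at h
  have h2 : 2 * (p / q - 1) / (p / q - 1 + 2) = 2 * (p - q) / (p + q) := by
    rw [show p / q - 1 + 2 = (p + q) / q by field_simp; ring,
      show 2 * (p / q - 1) = 2 * (p - q) / q by field_simp, div_div_div_cancel_right₀ hq.ne']
  rw [h2, div_le_iff₀ (by linarith)] at h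
  exact h

lemma two_mul_sub_le_entropySlope_sub {c a b : ℝ} (hc : 0 < c) (hba : b ≤ a) :
    2 * (a - b) ≤ (entropySlope c a - entropySlope c b) * (|a| + |b| + 2 / c) := by
  have key : ∀ {a b : ℝ}, 0 ≤ b → b ≤ a →
      2 * (a - b) ≤ (entropySlope c a - entropySlope c b) * (|a| + |b| + 2 / c) := by
    intro a b hb hba
    have ha := hb.trans hba
    rw [entropySlope_of_nonneg ha, entropySlope_of_nonneg hb, abs_of_nonneg ha, abs_of_nonneg hb]
    have h := two_mul_sub_le_log_sub_mul_add (p := c * a + 1) (q := c * b + 1) (by positivity)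
      (by gcongr)
    refine le_of_mul_le_mul_left ?_ hc
    calc c * (2 * (a - b)) = 2 * (c * a + 1 - (c * b + 1)) := by ring
      _ ≤ _ := h
      _ = _ := by field_simp; ring
  rcases le_total 0 b with hb | hb
  · exact key hb hba
  rcases le_total a 0 with ha | ha
  · have h := key (a := -b) (b := -a) (by linarith) (by linarith)
    rw [entropySlope_neg, entropySlope_neg, abs_neg, abs_neg] at h
    linarith
  · -- opposite signs: the product of the two arguments dominates their sum minus one
    obtain ⟨b, rfl⟩ : ∃ b', b = -b' := ⟨-b, by simp⟩
    have hb' : 0 ≤ b := by linarith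
    rw [entropySlope_neg, entropySlope_of_nonneg ha, entropySlope_of_nonneg hb', abs_neg,
      abs_of_nonneg ha, abs_of_nonneg hb']
    have h := two_mul_sub_le_log_sub_mul_add (p := c * (a + b) + 1) (q := 1) one_pos (by
      have : 0 ≤ c * (a + b) := by positivity
      linarith)
    have h2 : Real.log (c * (a + b) + 1) ≤ Real.log (c * a + 1) + Real.log (c * b + 1) := by
      rw [← Real.log_mul (by positivity) (by positivity)]
      refine Real.log_le_log (by positivity) ?_
      have : 0 ≤ c * a * (c * b) := by positivity
      linarith
    rw [Real.log_one, sub_zero] at h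
    refine le_of_mul_le_mul_left ?_ hc
    calc c * (2 * (a - -b)) = 2 * (c * (a + b) + 1 - 1) := by ring
      _ ≤ _ := h
      _ ≤ (Real.log (c * a + 1) + Real.log (c * b + 1)) * (c * (a + b) + 1 + 1) := by gcongr
      _ = _ := by field_simp; ring

lemma sq_div_le_entropySlope_sub_mul {c : ℝ} (hc : 0 < c) (a b : ℝ) :
    (a - b) ^ 2 / ((|a| + |b|) / 2 + 1 / c) ≤
      (entropySlope c a - entropySlope c b) * (a - b) := by
  have key : ∀ {a b : ℝ}, b ≤ a → (a - b) ^ 2 / ((|a| + |b|) / 2 + 1 / c) ≤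
      (entropySlope c a - entropySlope c b) * (a - b) := by
    intro a b hba
    rw [div_le_iff₀ (by positivity)]
    have h := mul_le_mul_of_nonneg_left (two_mul_sub_le_entropySlope_sub hc hba)
      (sub_nonneg.2 hba)
    have e : (|a| + |b| + 2 / c) = 2 * ((|a| + |b|) / 2 + 1 / c) := by ring
    rw [e] at h
    linarith
  rcases le_total b a with h | h
  · exact key h
  · have := key h
    rw [add_comm |a| |b|, sub_sq_comm a b]
    linarith

lemma hasDerivAt_entropy_of_nonneg {c t : ℝ} (hc : 0 < c) (ht : 0 ≤ t) :
    HasDerivAt (fun s => (s + 1 / c) * Real.log (c * s + 1) - s) (Real.log (c * t + 1)) t := by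
  have hne : c * t + 1 ≠ 0 := by positivity
  have h1 : HasDerivAt (fun s => c * s + 1) c t := by
    simpa using ((hasDerivAt_id t).const_mul c).add_const 1
  have h2 : HasDerivAt (fun s : ℝ => s + 1 / c) 1 t := (hasDerivAt_id t).add_const _
  refine ((h2.mul (h1.log hne)).sub (hasDerivAt_id t)).congr_deriv ?_
  rw [show (t + 1 / c) * (c / (c * t + 1)) = 1 by field_simp]
  ring

lemma hasDerivAt_entropy {c : ℝ} (hc : 0 < c) (t : ℝ) :
    HasDerivAt (fun s => (|s| + 1 / c) * Real.log (c * |s| + 1) - |s|) (entropySlope c t) t := by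
  rcases lt_trichotomy t 0 with ht | rfl | ht
  · have h := (hasDerivAt_entropy_of_nonneg hc (t := |t|) (abs_nonneg t)).comp t
      (hasDerivAt_abs_neg ht)
    refine h.congr_deriv ?_
    obtain ⟨s, rfl⟩ : ∃ s, t = -s := ⟨-t, by simp⟩
    have hs : 0 ≤ s := by linarith
    rw [entropySlope_neg, entropySlope_of_nonneg hs, abs_neg, abs_of_nonneg hs]
    ring
  · -- the one-sided derivative vanishes at the kink of `|·|`
    have h := hasDerivAt_entropy_of_nonneg hc le_rfl
    rw [hasDerivAt_iff_isLittleO] at h ⊢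
    have ht : Filter.Tendsto (fun s : ℝ => |s|) (nhds 0) (nhds 0) := by
      simpa using (continuous_abs (G := ℝ)).tendsto 0
    have h2 := h.comp_tendsto ht
    refine (h2.congr' (Filter.Eventually.of_forall fun s => ?_) (Filter.Eventually.of_forall
      fun s => rfl)).trans_isBigO ?_
    · simp [entropySlope]
    · refine Asymptotics.IsBigO.of_bound 1 (Filter.Eventually.of_forall fun s => ?_)
      simp
  · have h := (hasDerivAt_entropy_of_nonneg hc (t := |t|) (abs_nonneg t)).comp t
      (hasDerivAt_abs_pos ht)
    refine h.congr_deriv ?_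
    rw [entropySlope_of_nonneg ht.le, abs_of_pos ht]
    ring

/-- The gradient of `entropyLike`. -/
def entropyGrad {d : ℕ} (x : EuclideanSpace ℝ (Fin d)) : EuclideanSpace ℝ (Fin d) :=
  WithLp.toLp 2 fun i => entropySlope d (x i)

lemma inner_eq_sum {d : ℕ} (x y : EuclideanSpace ℝ (Fin d)) :
    inner ℝ x y = ∑ i, x i * y i := by
  simp [PiLp.inner_apply, mul_comm]

lemma hasGradientAt_entropyLike {d : ℕ} (hd : 0 < d) (x : EuclideanSpace ℝ (Fin d)) :
    HasGradientAt entropyLike (entropyGrad x) x := by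
  rw [hasGradientAt_iff_hasFDerivAt]
  have hd' : (0 : ℝ) < d := by exact_mod_cast hd
  have h : ∀ i ∈ Finset.univ, HasFDerivAt (fun y : EuclideanSpace ℝ (Fin d) =>
      (|y i| + 1 / (d : ℝ)) * Real.log ((d : ℝ) * |y i| + 1) - |y i|)
      (entropySlope d (x i) • EuclideanSpace.proj i) x := fun i _ =>
    (hasDerivAt_entropy hd' (x i)).comp_hasFDerivAt x
      (f := fun y : EuclideanSpace ℝ (Fin d) => y i) (EuclideanSpace.proj (𝕜 := ℝ) i).hasFDerivAt
  refine (HasFDerivAt.fun_sum h).congr_fderiv ?_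
  ext v
  simp [entropyGrad, inner_eq_sum]

lemma continuous_entropyGrad {d : ℕ} (hd : 0 < d) :
    Continuous (entropyGrad : EuclideanSpace ℝ (Fin d) → _) := by
  have hd' : (0 : ℝ) < d := by exact_mod_cast hd
  refine (PiLp.continuous_toLp 2 _).comp (continuous_pi fun i => ?_)
  exact (continuous_entropySlope hd').comp (by fun_prop)

lemma continuous_entropyLike {d : ℕ} (hd : 0 < d) :
    Continuous (entropyLike : EuclideanSpace ℝ (Fin d) → ℝ) :=
  continuous_iff_continuousAt.2 fun x => (hasGradientAt_entropyLike hd x).continuousAt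

lemma l1Norm_nonneg {d : ℕ} (x : EuclideanSpace ℝ (Fin d)) : 0 ≤ l1Norm x :=
  Finset.sum_nonneg fun _ _ => abs_nonneg _

lemma l1Norm_add_le {d : ℕ} (x y : EuclideanSpace ℝ (Fin d)) :
    l1Norm (x + y) ≤ l1Norm x + l1Norm y := by
  unfold l1Norm
  rw [← Finset.sum_add_distrib]
  exact Finset.sum_le_sum fun i _ => abs_add_le _ _

lemma l1Norm_neg {d : ℕ} (x : EuclideanSpace ℝ (Fin d)) : l1Norm (-x) = l1Norm x := by
  simp [l1Norm]

lemma l1Norm_sub_le {d : ℕ} (x y : EuclideanSpace ℝ (Fin d)) :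
    l1Norm (x - y) ≤ l1Norm x + l1Norm y := by
  rw [sub_eq_add_neg]
  simpa [l1Norm_neg] using l1Norm_add_le x (-y)

lemma l1Norm_sub_comm {d : ℕ} (x y : EuclideanSpace ℝ (Fin d)) :
    l1Norm (x - y) = l1Norm (y - x) := by
  rw [← l1Norm_neg, neg_sub]

lemma l1Norm_smul {d : ℕ} (a : ℝ) (x : EuclideanSpace ℝ (Fin d)) :
    l1Norm (a • x) = |a| * l1Norm x := by
  simp [l1Norm, abs_mul, Finset.mul_sum]

lemma continuous_l1Norm {d : ℕ} : Continuous (l1Norm : EuclideanSpace ℝ (Fin d) → ℝ) := by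
  unfold l1Norm
  fun_prop

lemma norm_le_l1Norm {d : ℕ} (x : EuclideanSpace ℝ (Fin d)) : ‖x‖ ≤ l1Norm x := by
  rw [EuclideanSpace.norm_eq]
  refine Real.sqrt_le_iff.2 ⟨l1Norm_nonneg x, ?_⟩
  simp only [Real.norm_eq_abs]
  exact Finset.sum_sq_le_sq_sum_of_nonneg fun i _ => abs_nonneg _

/-- The `ℓ_∞` norm, dual to `l1Norm`. -/
def supNorm {d : ℕ} (x : EuclideanSpace ℝ (Fin d)) : ℝ := ‖WithLp.ofLp x‖

lemma supNorm_nonneg {d : ℕ} (x : EuclideanSpace ℝ (Fin d)) : 0 ≤ supNorm x := norm_nonneg _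

lemma abs_apply_le_supNorm {d : ℕ} (x : EuclideanSpace ℝ (Fin d)) (i : Fin d) :
    |x i| ≤ supNorm x := norm_le_pi_norm (WithLp.ofLp x) i

lemma continuous_supNorm {d : ℕ} : Continuous (supNorm : EuclideanSpace ℝ (Fin d) → ℝ) := by
  unfold supNorm
  fun_prop

lemma inner_le_supNorm_mul_l1Norm {d : ℕ} (x y : EuclideanSpace ℝ (Fin d)) :
    inner ℝ x y ≤ supNorm x * l1Norm y := by
  rw [inner_eq_sum, l1Norm, Finset.mul_sum]
  refine Finset.sum_le_sum fun i _ => (le_abs_self _).trans ?_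
  rw [abs_mul]
  exact mul_le_mul_of_nonneg_right (abs_apply_le_supNorm x i) (abs_nonneg _)

/-- The gradient of `entropyLike` is strongly monotone with respect to the `ℓ₁` norm, with modulus
`1 / (M + 1)` on the ball of radius `M`: coordinatewise this is the comparison of the logarithmic
with the arithmetic mean, and the coordinates combine by the Cauchy–Schwarz inequality. -/
theorem l1Norm_sq_div_le_inner_entropyGrad {d : ℕ} (hd : 0 < d) {M : ℝ}
    {x y : EuclideanSpace ℝ (Fin d)} (hx : l1Norm x ≤ M) (hy : l1Norm y ≤ M) :
    l1Norm (x - y) ^ 2 / (M + 1) ≤ inner ℝ (entropyGrad x - entropyGrad y) (x - y) := by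
  have hd' : (0 : ℝ) < d := by exact_mod_cast hd
  have hM : 0 ≤ M := (l1Norm_nonneg x).trans hx
  have hsum : ∑ i, ((|x i| + |y i|) / 2 + 1 / (d : ℝ)) ≤ M + 1 := by
    rw [Finset.sum_add_distrib, ← Finset.sum_div, Finset.sum_add_distrib]
    simp only [Finset.sum_const, Finset.card_univ, Fintype.card_fin, nsmul_eq_mul]
    rw [mul_one_div_cancel hd'.ne']
    unfold l1Norm at hx hy
    linarith
  have hpos : 0 < ∑ i, ((|x i| + |y i|) / 2 + 1 / (d : ℝ)) := by
    have : Nonempty (Fin d) := ⟨⟨0, hd⟩⟩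
    exact Finset.sum_pos (fun i _ => by positivity) Finset.univ_nonempty
  calc l1Norm (x - y) ^ 2 / (M + 1)
      ≤ (∑ i, |(x - y) i|) ^ 2 / ∑ i, ((|x i| + |y i|) / 2 + 1 / (d : ℝ)) :=
        div_le_div_of_nonneg_left (sq_nonneg _) hpos hsum
    _ ≤ ∑ i, |(x - y) i| ^ 2 / ((|x i| + |y i|) / 2 + 1 / (d : ℝ)) :=
        Finset.sq_sum_div_le_sum_sq_div _ _ fun i _ => by positivity
    _ ≤ _ := by
        rw [inner_eq_sum]
        refine Finset.sum_le_sum fun i _ => ?_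
        rw [sq_abs]
        simpa [entropyGrad] using sq_div_le_entropySlope_sub_mul hd' (x i) (y i)

/-! ### Mirror steps -/

/-- A function with an `L`-Lipschitz gradient is within `L/2 ‖y - x‖²` of its linearisation. -/
theorem abs_sub_sub_inner_le {E : Type*} [NormedAddCommGroup E] [InnerProductSpace ℝ E]
    [CompleteSpace E] {F : E → ℝ} {F' : E → E} {L : ℝ} (hF : ∀ x, HasGradientAt F (F' x) x)
    (hL : ∀ x y, ‖F' x - F' y‖ ≤ L * ‖x - y‖) (x y : E) :
    |F y - F x - inner ℝ (F' x) (y - x)| ≤ L / 2 * ‖y - x‖ ^ 2 := by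
  set v := y - x with hv
  have hderiv : ∀ t : ℝ, HasDerivAt (fun t : ℝ => F (x + t • v) - F x - t * inner ℝ (F' x) v)
      (inner ℝ (F' (x + t • v) - F' x) v) t := by
    intro t
    have h1 : HasDerivAt (fun t : ℝ => x + t • v) v t := by
      simpa using ((hasDerivAt_id t).smul_const v).const_add x
    have h2 := ((hF (x + t • v)).hasFDerivAt.comp_hasDerivAt t h1)
    have h3 := (h2.sub_const (F x)).sub ((hasDerivAt_id t).mul_const (inner ℝ (F' x) v))
    refine h3.congr_deriv ?_
    simp [inner_sub_left]
  have hB : ∀ t : ℝ, HasDerivAt (fun t : ℝ => L / 2 * ‖v‖ ^ 2 * t ^ 2) (L * t * ‖v‖ ^ 2) t := by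
    intro t
    refine ((hasDerivAt_pow 2 t).const_mul (L / 2 * ‖v‖ ^ 2)).congr_deriv ?_
    push_cast
    ring
  have h := image_norm_le_of_norm_deriv_right_le_deriv_boundary (a := 0) (b := 1)
    (f := fun t : ℝ => F (x + t • v) - F x - t * inner ℝ (F' x) v)
    (f' := fun t : ℝ => inner ℝ (F' (x + t • v) - F' x) v)
    (B := fun t : ℝ => L / 2 * ‖v‖ ^ 2 * t ^ 2) (B' := fun t => L * t * ‖v‖ ^ 2)
    (fun t _ => (hderiv t).continuousAt.continuousWithinAt)
    (fun t _ => (hderiv t).hasDerivWithinAt) (by simp) hB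
    (fun t ht => by
      refine (norm_inner_le_norm _ _).trans ?_
      have := hL (x + t • v) x
      rw [add_sub_cancel_left, norm_smul, Real.norm_of_nonneg ht.1] at this
      calc _ ≤ L * (t * ‖v‖) * ‖v‖ := by gcongr
        _ = _ := by ring)
    (Set.right_mem_Icc.2 zero_le_one)
  simpa [hv] using h

section MirrorStep

variable {d : ℕ} {r : EuclideanSpace ℝ (Fin d) → ℝ} {K : Set (EuclideanSpace ℝ (Fin d))}

/-- First-order optimality of a mirror step: the minimiser solves a variational inequality. -/
theorem IsMirrorMin.variational (hd : 0 < d) (hK : Convex ℝ K) (hr : ConvexOn ℝ Set.univ r)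
    {x g y z : EuclideanSpace ℝ (Fin d)} {η : ℝ} (h : IsMirrorMin entropyLike r K x g η y)
    (hz : z ∈ K) :
    0 ≤ inner ℝ g (z - y) + (r z - r y) +
      η * inner ℝ (entropyGrad y - entropyGrad x) (z - y) := by
  obtain ⟨hy, hmin⟩ := h
  set v := z - y with hv
  have hgrad : gradient entropyLike x = entropyGrad x := (hasGradientAt_entropyLike hd x).gradient
  -- the smooth part of the objective along the segment from `y` to `z`
  set s : ℝ → ℝ := fun t => inner ℝ g (y + t • v) + η * bregman entropyLike (y + t • v) x with hs
  have hderiv : HasDerivAt s (inner ℝ g v + η * inner ℝ (entropyGrad y - entropyGrad x) v) 0 := by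
    have h1 : HasDerivAt (fun t : ℝ => y + t • v) v 0 := by
      simpa using ((hasDerivAt_id (0 : ℝ)).smul_const v).const_add y
    have h2 : HasDerivAt (fun t : ℝ => entropyLike (y + t • v)) (inner ℝ (entropyGrad y) v) 0 := by
      have hy0 : y + (0 : ℝ) • v = y := by simp
      have := (hy0.symm ▸ hasGradientAt_entropyLike hd y :
        HasGradientAt entropyLike (entropyGrad y) (y + (0 : ℝ) • v))
      refine (this.hasFDerivAt.comp_hasDerivAt (0 : ℝ) h1).congr_deriv ?_
      simp
    have h3 : ∀ w : EuclideanSpace ℝ (Fin d),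
        HasDerivAt (fun t : ℝ => inner ℝ w (y + t • v)) (inner ℝ w v) 0 := by
      intro w
      have := (hasDerivAt_const (0 : ℝ) w).inner ℝ h1
      simpa using this
    have h4 : HasDerivAt (fun t : ℝ => inner ℝ (entropyGrad x) (y + t • v - x))
        (inner ℝ (entropyGrad x) v) 0 := by
      have := (h3 (entropyGrad x)).sub_const (inner ℝ (entropyGrad x) x)
      refine this.congr_of_eventuallyEq (Filter.Eventually.of_forall fun t => ?_)
      simp [inner_sub_right]
    have h5 := (h3 g).add (((h2.sub_const (entropyLike x)).sub h4).const_mul η)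
    rw [← inner_sub_left] at h5
    simp only [hs, bregman, hgrad]
    exact h5
  have hlim := hderiv.tendsto_slope_zero_right
  have hge : -(r z - r y) ≤ inner ℝ g v + η * inner ℝ (entropyGrad y - entropyGrad x) v := by
    refine ge_of_tendsto hlim ?_
    filter_upwards [Ioo_mem_nhdsGT (zero_lt_one (α := ℝ))] with t ht
    have hseg : y + t • v = (1 - t) • y + t • z := by
      rw [hv]
      module
    have hmem : y + t • v ∈ K := by
      rw [hseg]
      exact hK hy hz (sub_nonneg.2 ht.2.le) ht.1.le (by ring)
    have h1 := hmin hmem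
    simp only [Set.mem_ofPred_eq, mirrorObjective] at h1
    have h2 : r (y + t • v) ≤ (1 - t) * r y + t * r z := by
      rw [hseg]
      exact hr.2 (Set.mem_univ y) (Set.mem_univ z) (sub_nonneg.2 ht.2.le) ht.1.le (by ring)
    have h3 : -(r z - r y) * t ≤ s t - s 0 := by
      simp only [hs, zero_smul, add_zero]
      linarith
    rw [zero_add, smul_eq_mul, inv_mul_eq_div, le_div_iff₀ ht.1]
    exact h3
  linarith

/-- The sufficient decrease of a mirror step inside the `ℓ₁` ball of radius `D`. -/
theorem IsMirrorMin.l1Norm_sq_le (hd : 0 < d) (hK : Convex ℝ K) (hr : ConvexOn ℝ Set.univ r)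
    {x g y : EuclideanSpace ℝ (Fin d)} {η D : ℝ} (hη : 0 ≤ η)
    (h : IsMirrorMin entropyLike r K x g η y) (hx : x ∈ K) (hxD : l1Norm x ≤ D)
    (hyD : l1Norm y ≤ D) :
    η * (l1Norm (y - x) ^ 2 / (D + 1)) ≤ inner ℝ g (x - y) + (r x - r y) := by
  have h1 := h.variational hd hK hr hx
  have h2 := mul_le_mul_of_nonneg_left (l1Norm_sq_div_le_inner_entropyGrad hd hyD hxD) hη
  rw [← neg_sub x y, inner_neg_right, neg_sub] at h2
  linarith

/-- A mirror step depends on its direction in a Lipschitz way, from `ℓ_∞` to `ℓ₁`. -/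
theorem IsMirrorMin.mul_l1Norm_sub_le (hd : 0 < d) (hK : Convex ℝ K)
    (hr : ConvexOn ℝ Set.univ r) {x g₁ g₂ y₁ y₂ : EuclideanSpace ℝ (Fin d)} {η D : ℝ} (hη : 0 ≤ η)
    (h₁ : IsMirrorMin entropyLike r K x g₁ η y₁) (h₂ : IsMirrorMin entropyLike r K x g₂ η y₂)
    (hy₁ : l1Norm y₁ ≤ D) (hy₂ : l1Norm y₂ ≤ D) :
    η / (D + 1) * l1Norm (y₁ - y₂) ≤ supNorm (g₁ - g₂) := by
  rcases (l1Norm_nonneg (y₁ - y₂)).eq_or_lt with h0 | h0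
  · rw [← h0, mul_zero]
    exact supNorm_nonneg _
  have e₁ := h₁.variational hd hK hr h₂.1
  have e₂ := h₂.variational hd hK hr h₁.1
  have e₃ := mul_le_mul_of_nonneg_left (l1Norm_sq_div_le_inner_entropyGrad hd hy₁ hy₂) hη
  have e₄ := inner_le_supNorm_mul_l1Norm (g₁ - g₂) (y₂ - y₁)
  rw [l1Norm_sub_comm] at e₄
  rw [← neg_sub y₁ y₂] at e₁ e₄
  simp only [inner_neg_right, inner_sub_left] at e₁ e₂ e₃ e₄
  refine le_of_mul_le_mul_right ?_ h0
  calc η / (D + 1) * l1Norm (y₁ - y₂) * l1Norm (y₁ - y₂)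
      = η * (l1Norm (y₁ - y₂) ^ 2 / (D + 1)) := by ring
    _ ≤ _ := by linarith

/-- If all mirror steps from `K` stay in the `ℓ₁` ball of radius `D`, then so does `K`: for large
stepsizes and direction `0`, the step from `x` is close to `x`. -/
theorem l1Norm_le_of_genProj (hd : 0 < d) (hK : Convex ℝ K) (hr : ConvexOn ℝ Set.univ r)
    (hrc : Continuous r) {D : ℝ}
    (h : ∀ η : ℝ, 0 < η → ∀ x ∈ K, ∀ g, l1Norm (genProj entropyLike r K x g η) ≤ D)
    {x : EuclideanSpace ℝ (Fin d)} (hx : x ∈ K) : l1Norm x ≤ D := by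
  by_contra! hlt
  have hball : IsCompact {y : EuclideanSpace ℝ (Fin d) | l1Norm y ≤ D} := by
    refine Metric.isCompact_of_isClosed_isBounded
      (isClosed_le continuous_l1Norm continuous_const) ?_
    refine (Metric.isBounded_closedBall (x := (0 : EuclideanSpace ℝ (Fin d))) (r := D)).subset ?_
    intro y hy
    rw [mem_closedBall_zero_iff]
    exact (norm_le_l1Norm y).trans hy
  obtain ⟨b, hb⟩ := (hball.image hrc).bddBelow
  have hM : 0 < l1Norm x + 1 := by linarith [l1Norm_nonneg x]
  have hgap : 0 < (l1Norm x - D) ^ 2 / (l1Norm x + 1) := by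
    have : 0 < l1Norm x - D := by linarith
    positivity
  obtain ⟨n, hn⟩ := exists_nat_gt ((r x - b) / ((l1Norm x - D) ^ 2 / (l1Norm x + 1)))
  rw [div_lt_iff₀ hgap] at hn
  have hn1 : (0 : ℝ) < n + 1 := by positivity
  have hyD := h (n + 1) hn1 x hx 0
  unfold genProj at hyD
  split_ifs at hyD with hex
  · have hmin := hex.choose_spec
    set y := hex.choose
    have h1 := hmin.l1Norm_sq_le hd hK hr hn1.le hx le_rfl (hyD.trans hlt.le)
    have h2 : l1Norm x - D ≤ l1Norm (y - x) := by
      have := l1Norm_add_le (x - y) y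
      rw [sub_add_cancel, l1Norm_sub_comm] at this
      linarith
    have h3 : (l1Norm x - D) ^ 2 / (l1Norm x + 1) ≤ l1Norm (y - x) ^ 2 / (l1Norm x + 1) := by
      have : 0 ≤ l1Norm x - D := by linarith
      gcongr
    have h4 : b ≤ r y := hb ⟨y, hyD, rfl⟩
    have h5 := mul_le_mul_of_nonneg_left h3 hn1.le
    rw [inner_zero_left] at h1
    nlinarith
  · linarith

lemma isCompact_of_l1Norm_le (hK : IsClosed K) {D : ℝ} (hKD : ∀ x ∈ K, l1Norm x ≤ D) :
    IsCompact K := by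
  refine Metric.isCompact_of_isClosed_isBounded hK ?_
  refine (Metric.isBounded_closedBall (x := (0 : EuclideanSpace ℝ (Fin d))) (r := D)).subset ?_
  intro y hy
  rw [mem_closedBall_zero_iff]
  exact (norm_le_l1Norm y).trans (hKD y hy)

theorem isMirrorMin_genProj (hd : 0 < d) (hK : IsCompact K) (hne : K.Nonempty)
    (hrc : Continuous r) (x g : EuclideanSpace ℝ (Fin d)) (η : ℝ) :
    IsMirrorMin entropyLike r K x g η (genProj entropyLike r K x g η) := by
  have hcont : Continuous (mirrorObjective entropyLike r x g η) := by
    have := continuous_entropyLike hd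
    unfold mirrorObjective bregman
    fun_prop
  obtain ⟨y, hy, hmin⟩ := hK.exists_isMinOn hne hcont.continuousOn
  have hex : ∃ y, IsMirrorMin entropyLike r K x g η y := ⟨y, hy, hmin⟩
  unfold genProj
  rw [dif_pos hex]
  exact hex.choose_spec

/-- A quantitative form of the joint continuity of the mirror step in its parameters: after
division of the variational inequalities by the stepsizes, the step depends on `(x, g, η)` only
through `∇φ(x) - g / η` and `1 / η`. -/
lemma IsMirrorMin.l1Norm_sub_sq_le (hd : 0 < d) (hK : Convex ℝ K) (hr : ConvexOn ℝ Set.univ r)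
    {D M : ℝ} (hKD : ∀ x ∈ K, l1Norm x ≤ D) (hM : ∀ x ∈ K, |r x| ≤ M)
    {x₁ x₂ g₁ g₂ y₁ y₂ : EuclideanSpace ℝ (Fin d)} {η₁ η₂ : ℝ} (hη₁ : 0 < η₁) (hη₂ : 0 < η₂)
    (h₁ : IsMirrorMin entropyLike r K x₁ g₁ η₁ y₁) (h₂ : IsMirrorMin entropyLike r K x₂ g₂ η₂ y₂) :
    l1Norm (y₁ - y₂) ^ 2 / (D + 1) ≤ |η₁⁻¹ - η₂⁻¹| * (2 * M) +
      ‖(entropyGrad x₁ - η₁⁻¹ • g₁) - (entropyGrad x₂ - η₂⁻¹ • g₂)‖ * (2 * D) := by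
  have e₁ := h₁.variational hd hK hr h₂.1
  have e₂ := h₂.variational hd hK hr h₁.1
  have e₃ := l1Norm_sq_div_le_inner_entropyGrad hd (hKD _ h₁.1) (hKD _ h₂.1)
  have f₁ := mul_nonneg (inv_pos.2 hη₁).le e₁
  have f₂ := mul_nonneg (inv_pos.2 hη₂).le e₂
  rw [mul_add, inv_mul_cancel_left₀ hη₁.ne', mul_add] at f₁
  rw [mul_add, inv_mul_cancel_left₀ hη₂.ne', mul_add] at f₂
  set w := (entropyGrad x₁ - η₁⁻¹ • g₁) - (entropyGrad x₂ - η₂⁻¹ • g₂) with hw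
  have e₄ : inner ℝ w (y₁ - y₂) ≤ ‖w‖ * (2 * D) := by
    refine (real_inner_le_norm _ _).trans ?_
    gcongr
    refine (norm_le_l1Norm _).trans ((l1Norm_sub_le _ _).trans ?_)
    linarith [hKD _ h₁.1, hKD _ h₂.1]
  have e₅ : (η₁⁻¹ - η₂⁻¹) * (r y₂ - r y₁) ≤ |η₁⁻¹ - η₂⁻¹| * (2 * M) := by
    refine (le_abs_self _).trans ?_
    rw [abs_mul]
    gcongr
    refine (abs_sub _ _).trans ?_
    linarith [hM _ h₁.1, hM _ h₂.1]
  refine le_trans ?_ (add_le_add e₅ e₄)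
  rw [← neg_sub y₁ y₂] at f₁
  rw [hw]
  simp only [inner_neg_right, inner_sub_left, inner_smul_left, RCLike.conj_to_real] at *
  linarith

theorem continuousOn_genProj (hd : 0 < d) (hK : IsCompact K) (hne : K.Nonempty)
    (hconv : Convex ℝ K) (hr : ConvexOn ℝ Set.univ r) (hrc : Continuous r) {D : ℝ} (hD : 0 ≤ D)
    (hKD : ∀ x ∈ K, l1Norm x ≤ D) :
    ContinuousOn (fun p : EuclideanSpace ℝ (Fin d) × EuclideanSpace ℝ (Fin d) × ℝ =>
      genProj entropyLike r K p.1 p.2.1 p.2.2) {p | 0 < p.2.2} := by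
  obtain ⟨M, hM⟩ := hK.exists_bound_of_continuousOn hrc.continuousOn
  intro p₀ hp₀
  have hp₀' : p₀.2.2 ≠ 0 := ne_of_gt hp₀
  refine ContinuousAt.continuousWithinAt ?_
  set b : EuclideanSpace ℝ (Fin d) × EuclideanSpace ℝ (Fin d) × ℝ → ℝ := fun p =>
    |p.2.2⁻¹ - p₀.2.2⁻¹| * (2 * M) + ‖(entropyGrad p.1 - p.2.2⁻¹ • p.2.1) -
      (entropyGrad p₀.1 - p₀.2.2⁻¹ • p₀.2.1)‖ * (2 * D) with hb
  have hbc : ContinuousAt b p₀ := by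
    have h1 : ContinuousAt (fun p : EuclideanSpace ℝ (Fin d) × EuclideanSpace ℝ (Fin d) × ℝ =>
        p.2.2⁻¹) p₀ := ContinuousAt.inv₀ (by fun_prop) hp₀'
    have h2 : ContinuousAt (fun p : EuclideanSpace ℝ (Fin d) × EuclideanSpace ℝ (Fin d) × ℝ =>
        entropyGrad p.1) p₀ := ((continuous_entropyGrad hd).comp continuous_fst).continuousAt
    have h3 : ContinuousAt (fun p : EuclideanSpace ℝ (Fin d) × EuclideanSpace ℝ (Fin d) × ℝ =>
        p.2.1) p₀ := by fun_prop
    exact ((h1.sub continuousAt_const).abs.mul continuousAt_const).add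
      (((h2.sub (h1.smul h3)).sub continuousAt_const).norm.mul continuousAt_const)
  have hb0 : Filter.Tendsto (fun p => Real.sqrt ((D + 1) * b p)) (nhds p₀) (nhds 0) := by
    have h1 : ContinuousAt (fun p => Real.sqrt ((D + 1) * b p)) p₀ :=
      (continuousAt_const.mul hbc).sqrt
    have h2 : b p₀ = 0 := by simp [hb]
    have h3 := h1.tendsto
    rwa [h2, mul_zero, Real.sqrt_zero] at h3
  rw [ContinuousAt, tendsto_iff_norm_sub_tendsto_zero]
  refine squeeze_zero' (Filter.Eventually.of_forall fun _ => norm_nonneg _) ?_ hb0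
  have hopen : ∀ᶠ p in nhds p₀, 0 < p.2.2 := by
    have : ContinuousAt (fun p : EuclideanSpace ℝ (Fin d) × EuclideanSpace ℝ (Fin d) × ℝ =>
      p.2.2) p₀ := by fun_prop
    exact this.eventually (lt_mem_nhds hp₀)
  filter_upwards [hopen] with p hp
  have h := IsMirrorMin.l1Norm_sub_sq_le hd hconv hr hKD hM hp hp₀
    (isMirrorMin_genProj hd hK hne hrc p.1 p.2.1 p.2.2)
    (isMirrorMin_genProj hd hK hne hrc p₀.1 p₀.2.1 p₀.2.2)
  rw [div_le_iff₀' (by positivity)] at h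
  exact (norm_le_l1Norm _).trans (Real.le_sqrt_of_sq_le h)

theorem measurable_genProj (hd : 0 < d) (hK : IsCompact K) (hne : K.Nonempty)
    (hconv : Convex ℝ K) (hr : ConvexOn ℝ Set.univ r) (hrc : Continuous r) {D : ℝ} (hD : 0 ≤ D)
    (hKD : ∀ x ∈ K, l1Norm x ≤ D) {Ω : Type*} {mΩ : MeasurableSpace Ω}
    {x g : Ω → EuclideanSpace ℝ (Fin d)} {η : Ω → ℝ} (hx : Measurable x) (hg : Measurable g)
    (hη : Measurable η) (hpos : ∀ ω, 0 < η ω) :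
    Measurable fun ω => genProj entropyLike r K (x ω) (g ω) (η ω) := by
  have hcont := (continuousOn_genProj hd hK hne hconv hr hrc hD hKD).domRestrict
  have hmeas : Measurable fun ω => (x ω, g ω, η ω) := hx.prodMk (hg.prodMk hη)
  have hmem : ∀ ω, (x ω, g ω, η ω) ∈
      {p : EuclideanSpace ℝ (Fin d) × EuclideanSpace ℝ (Fin d) × ℝ | 0 < p.2.2} := hpos
  have h := hcont.measurable.comp (hmeas.subtype_mk (h := hmem))
  exact h

/-- A mirror step with `c φ` and stepsize `η / c` is a mirror step with `φ` and stepsize `η`. -/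
lemma gradMap_const_mul_entropyLike (hd : 0 < d) {c : ℝ} (hc : c ≠ 0)
    (x g : EuclideanSpace ℝ (Fin d)) (η : ℝ) :
    gradMap (fun y => c * entropyLike y) r K x g (η / c) =
      (η / c) • (x - genProj entropyLike r K x g η) := by
  have hobj : mirrorObjective (fun y => c * entropyLike y) r x g (η / c) =
      mirrorObjective entropyLike r x g η := by
    have hgrad : gradient (fun y : EuclideanSpace ℝ (Fin d) => c * entropyLike y) x =
        c • gradient entropyLike x := by
      rw [(hasGradientAt_entropyLike hd x).gradient]
      refine HasGradientAt.gradient ?_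
      rw [hasGradientAt_iff_hasFDerivAt, map_smul]
      exact (hasGradientAt_entropyLike hd x).hasFDerivAt.const_mul c
    funext y
    unfold mirrorObjective bregman
    rw [hgrad, inner_smul_left, RCLike.conj_to_real]
    field_simp
  unfold gradMap genProj IsMirrorMin
  rw [hobj]

end MirrorStep

/-! ### Moments of the mini-batch estimator -/

instance : IsProbabilityMeasure rademacher where
  measure_univ := by simp [rademacher, ENNReal.inv_two_add_inv_two]

lemma integrable_rademacher (f : ℝ → ℝ) : Integrable f rademacher := by
  unfold rademacher
  refine Integrable.add_measure ?_ ?_ <;>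
    exact (integrable_dirac (by simp)).smul_measure (by simp)

lemma integral_rademacher (f : ℝ → ℝ) : ∫ s, f s ∂rademacher = (f 1 + f (-1)) / 2 := by
  unfold rademacher
  rw [integral_add_measure ((integrable_dirac (by simp)).smul_measure (by simp))
    ((integrable_dirac (by simp)).smul_measure (by simp)), integral_smul_measure,
    integral_smul_measure, integral_dirac, integral_dirac]
  simp
  ring

lemma ae_rademacher_pi (d : ℕ) :
    ∀ᵐ u ∂(Measure.pi fun _ : Fin d => rademacher), ∀ i, u i = 1 ∨ u i = -1 := by
  rw [ae_all_iff]
  intro i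
  have h : ∀ᵐ s ∂rademacher, s = 1 ∨ s = -1 := by
    have hm : MeasurableSet {s : ℝ | s = 1 ∨ s = -1} :=
      (measurableSet_singleton (1 : ℝ)).union (measurableSet_singleton (-1 : ℝ))
    unfold rademacher
    rw [ae_add_measure_iff]
    constructor <;> refine Measure.ae_smul_measure ?_ _ <;> rw [ae_dirac_iff hm] <;> simp
  exact (measurePreserving_eval (fun _ : Fin d => rademacher) i).quasiMeasurePreserving.ae h

/-- The exponential moments of a coordinate of `⟨v, u⟩ u` for a Rademacher vector `u`. Since
`uᵢ = ±1`, the exponential `exp (λ uᵢ ⟨v, u⟩)` is a sum over the two signs of `uᵢ` of products of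
functions of single coordinates, and the integral factorises. -/
lemma integral_exp_sign_mul_le {d : ℕ} (v : Fin d → ℝ) (i : Fin d) (lam : ℝ) :
    ∫ u, Real.exp (lam * ((∑ k, v k * u k) * u i)) ∂(Measure.pi fun _ : Fin d => rademacher) ≤
      Real.exp (lam * v i) * Real.exp (lam ^ 2 * (∑ k, v k ^ 2) / 2) := by
  set f : ℝ → Fin d → ℝ → ℝ := fun ε k s =>
    (if k = i then (1 + ε * s) / 2 else 1) * Real.exp (ε * lam * v k * s) with hf
  have hint : ∀ ε : ℝ, Integrable (fun u : Fin d → ℝ => ∏ k, f ε k (u k))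
      (Measure.pi fun _ : Fin d => rademacher) := fun ε =>
    Integrable.fintype_prod (fun k => integrable_rademacher (f ε k))
  have hprod : ∀ ε : ℝ, ∀ u : Fin d → ℝ,
      ∏ k, f ε k (u k) = (1 + ε * u i) / 2 * Real.exp (ε * lam * ∑ k, v k * u k) := by
    intro ε u
    simp only [hf, Finset.prod_mul_distrib, Finset.prod_ite_eq', Finset.mem_univ, if_true]
    rw [← Real.exp_sum, Finset.mul_sum]
    simp only [mul_assoc]
  have hval : ∀ ε : ℝ, ε = 1 ∨ ε = -1 →
      ∫ u, ∏ k, f ε k (u k) ∂(Measure.pi fun _ : Fin d => rademacher) ≤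
        Real.exp (lam * v i) * Real.exp (lam ^ 2 * (∑ k, v k ^ 2) / 2) / 2 := by
    intro ε hε
    rw [integral_fintype_prod_eq_prod]
    simp only [integral_rademacher]
    have hle : ∀ k ∈ Finset.univ, (f ε k 1 + f ε k (-1)) / 2 ≤
        (if k = i then Real.exp (lam * v i) / 2 else 1) *
          Real.exp (lam ^ 2 * v k ^ 2 / 2) := by
      intro k _
      by_cases hk : k = i
      · subst hk
        have h1 : (f ε k 1 + f ε k (-1)) / 2 = Real.exp (lam * v k) / 2 := by
          rcases hε with rfl | rfl <;> simp [hf]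
        rw [h1, if_pos rfl]
        refine le_mul_of_one_le_right (by positivity) (Real.one_le_exp (by positivity))
      · have h2 := Real.cosh_le_exp_half_sq (lam * v k)
        rw [Real.cosh_eq] at h2
        rw [mul_pow] at h2
        rcases hε with rfl | rfl
        · simpa [hf, hk] using h2
        · simpa [hf, hk, add_comm] using h2
    refine (Finset.prod_le_prod (fun k _ => ?_) hle).trans_eq ?_
    · rcases hε with rfl | rfl <;> simp only [hf] <;> split_ifs <;> norm_num <;> positivity
    · rw [Finset.prod_mul_distrib, Finset.prod_ite_eq' Finset.univ i, if_pos (Finset.mem_univ i),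
        ← Real.exp_sum, ← Finset.sum_div, ← Finset.mul_sum]
      ring
  have hae : (fun u : Fin d → ℝ => Real.exp (lam * ((∑ k, v k * u k) * u i)))
      =ᵐ[Measure.pi fun _ : Fin d => rademacher]
      fun u => ∏ k, f 1 k (u k) + ∏ k, f (-1) k (u k) := by
    filter_upwards [ae_rademacher_pi d] with u hu
    rw [hprod, hprod]
    rcases hu i with h | h <;> rw [h] <;> norm_num
  rw [integral_congr_ae hae, integral_add (hint 1) (hint (-1))]
  linarith [hval 1 (Or.inl rfl), hval (-1) (Or.inr rfl)]

section Sample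

variable {d : ℕ} {Ξ : Type*} [MeasurableSpace Ξ]

/-- The law of one sample: a Rademacher vector and an independent realisation of `ξ`. -/
def sampleLaw (d : ℕ) (μ : Measure Ξ) : Measure ((Fin d → ℝ) × Ξ) :=
  (Measure.pi fun _ : Fin d => rademacher).prod μ

instance (μ : Measure Ξ) [IsProbabilityMeasure μ] : IsProbabilityMeasure (sampleLaw d μ) := by
  unfold sampleLaw
  infer_instance

lemma ae_sampleLaw (μ : Measure Ξ) [IsProbabilityMeasure μ] :
    ∀ᵐ p ∂(sampleLaw d μ), ∀ i, p.1 i = 1 ∨ p.1 i = -1 := by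
  unfold sampleLaw
  exact (measurePreserving_fst (μ := Measure.pi fun _ : Fin d => rademacher)
    (ν := μ)).quasiMeasurePreserving.ae (ae_rademacher_pi d)

/-- The centred linear part `⟨v(ξ), u⟩ u - E[v]` of the two-point estimator for a sample `(u, ξ)`,
where `v(ξ)` is the stochastic gradient. -/
def linearNoise (μ : Measure Ξ) (v : Ξ → EuclideanSpace ℝ (Fin d)) (p : (Fin d → ℝ) × Ξ) :
    EuclideanSpace ℝ (Fin d) :=
  (inner ℝ (v p.2) (WithLp.toLp 2 p.1) : ℝ) • WithLp.toLp 2 p.1 - ∫ ξ, v ξ ∂μ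

lemma measurable_linearNoise (μ : Measure Ξ) {v : Ξ → EuclideanSpace ℝ (Fin d)}
    (hv : Measurable v) : Measurable (linearNoise μ v) := by
  have h1 : Measurable fun p : (Fin d → ℝ) × Ξ =>
      (WithLp.toLp 2 p.1 : EuclideanSpace ℝ (Fin d)) :=
    (PiLp.continuous_toLp 2 _).measurable.comp measurable_fst
  unfold linearNoise
  exact ((Measurable.inner (𝕜 := ℝ) (hv.comp measurable_snd) h1).smul h1).sub_const _

lemma linearNoise_apply (μ : Measure Ξ) {v : Ξ → EuclideanSpace ℝ (Fin d)}
    (hv : Integrable v μ) (p : (Fin d → ℝ) × Ξ) (i : Fin d) :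
    linearNoise μ v p i = (∑ k, v p.2 k * p.1 k) * p.1 i - ∫ ξ, v ξ i ∂μ := by
  have h : (∫ ξ, v ξ ∂μ) i = ∫ ξ, v ξ i ∂μ :=
    ((EuclideanSpace.proj (𝕜 := ℝ) i).integral_comp_comm hv).symm
  simp [linearNoise, inner_eq_sum, h]

lemma abs_apply_le_norm (x : EuclideanSpace ℝ (Fin d)) (i : Fin d) : |x i| ≤ ‖x‖ :=
  PiLp.norm_apply_le x i

lemma integrable_of_norm_le (μ : Measure Ξ) [IsProbabilityMeasure μ]
    {v : Ξ → EuclideanSpace ℝ (Fin d)} (hv : Measurable v) {G : ℝ} (hG : ∀ ξ, ‖v ξ‖ ≤ G) :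
    Integrable v μ :=
  Integrable.of_bound hv.aestronglyMeasurable G (Filter.Eventually.of_forall hG)

lemma integrable_exp_linearNoise (μ : Measure Ξ) [IsProbabilityMeasure μ]
    {v : Ξ → EuclideanSpace ℝ (Fin d)} (hv : Measurable v) {G : ℝ} (hG : ∀ ξ, ‖v ξ‖ ≤ G)
    (i : Fin d) (lam : ℝ) :
    Integrable (fun p => Real.exp (lam * linearNoise μ v p i)) (sampleLaw d μ) := by
  have hmeas : Measurable fun p => Real.exp (lam * linearNoise μ v p i) := by
    have := measurable_linearNoise μ hv
    fun_prop
  refine Integrable.of_bound hmeas.aestronglyMeasurable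
    (Real.exp (|lam| * (∑ _k : Fin d, G + |∫ ξ, v ξ i ∂μ|))) ?_
  filter_upwards [ae_sampleLaw μ] with p hp
  have habs : ∀ k, |p.1 k| = 1 := fun k => by rcases hp k with h | h <;> simp [h]
  rw [Real.norm_of_nonneg (Real.exp_pos _).le, Real.exp_le_exp]
  refine (le_abs_self _).trans ?_
  rw [abs_mul, linearNoise_apply μ (integrable_of_norm_le μ hv hG)]
  gcongr
  refine (abs_sub _ _).trans ?_
  rw [abs_mul, habs, mul_one]
  gcongr
  refine (Finset.abs_sum_le_sum_abs _ _).trans (Finset.sum_le_sum fun k _ => ?_)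
  rw [abs_mul, habs, mul_one]
  exact (abs_apply_le_norm _ _).trans (hG _)

/-- The coordinates of the noise are sub-Gaussian: the Rademacher vector contributes a variance
proxy `G²`, and so does, by Hoeffding's lemma, the stochastic gradient. -/
lemma integral_exp_linearNoise_le (μ : Measure Ξ) [IsProbabilityMeasure μ]
    {v : Ξ → EuclideanSpace ℝ (Fin d)} (hv : Measurable v) {G : ℝ} (hG : ∀ ξ, ‖v ξ‖ ≤ G)
    (i : Fin d) (lam : ℝ) :
    ∫ p, Real.exp (lam * linearNoise μ v p i) ∂(sampleLaw d μ) ≤ Real.exp (lam ^ 2 * G ^ 2) := by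
  have hint := integrable_exp_linearNoise μ hv hG i lam
  have hvint := integrable_of_norm_le μ hv hG
  have hvi : Measurable fun ξ => v ξ i := by fun_prop
  have hIcc : ∀ᵐ ξ ∂μ, v ξ i ∈ Set.Icc (-G) G :=
    Filter.Eventually.of_forall fun ξ => abs_le.1 ((abs_apply_le_norm _ _).trans (hG ξ))
  have hsub := hasSubgaussianMGF_of_mem_Icc hvi.aemeasurable hIcc
  have hmgf := hsub.mgf_le lam
  have hc : (((‖G - -G‖₊ / 2) ^ 2 : NNReal) : ℝ) = G ^ 2 := by
    push_cast
    rw [Real.norm_eq_abs, div_pow, sq_abs]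
    ring
  rw [hc, mgf] at hmgf
  unfold sampleLaw at hint ⊢
  rw [integral_prod_symm _ hint]
  calc ∫ ξ, ∫ u, Real.exp (lam * linearNoise μ v (u, ξ) i)
        ∂(Measure.pi fun _ : Fin d => rademacher) ∂μ
      ≤ ∫ ξ, Real.exp (lam * (v ξ i - ∫ ξ, v ξ i ∂μ)) * Real.exp (lam ^ 2 * G ^ 2 / 2) ∂μ := by
        refine integral_mono hint.integral_prod_right
          ((hsub.integrable_exp_mul lam).mul_const _) fun ξ => ?_
        have h1 := integral_exp_sign_mul_le (fun k => v ξ k) i lam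
        have h2 : ∑ k, v ξ k ^ 2 ≤ G ^ 2 := by
          have h3 := EuclideanSpace.real_norm_sq_eq (v ξ)
          rw [← h3]
          have := hG ξ
          gcongr
        have h4 : ∀ u : Fin d → ℝ, Real.exp (lam * linearNoise μ v (u, ξ) i) =
            Real.exp (lam * ((∑ k, v ξ k * u k) * u i)) *
              Real.exp (-(lam * ∫ ξ, v ξ i ∂μ)) := by
          intro u
          rw [linearNoise_apply μ hvint, ← Real.exp_add]
          congr 1
          ring
        simp only [h4]
        rw [integral_mul_const]
        calc _ ≤ (Real.exp (lam * v ξ i) * Real.exp (lam ^ 2 * (∑ k, v ξ k ^ 2) / 2)) *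
              Real.exp (-(lam * ∫ ξ, v ξ i ∂μ)) := by gcongr
          _ ≤ (Real.exp (lam * v ξ i) * Real.exp (lam ^ 2 * G ^ 2 / 2)) *
              Real.exp (-(lam * ∫ ξ, v ξ i ∂μ)) := by gcongr
          _ = _ := by
            rw [mul_sub, sub_eq_add_neg, Real.exp_add]
            ring
    _ ≤ Real.exp (G ^ 2 * lam ^ 2 / 2) * Real.exp (lam ^ 2 * G ^ 2 / 2) := by
        rw [integral_mul_const]
        gcongr
    _ = _ := by
        rw [← Real.exp_add]
        congr 1
        ring

end Sample

/-- An exponential majorant of the square that is tight near `|z| = c`. -/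
lemma sq_le_add_exp {c z : ℝ} (hc : 1 ≤ c) :
    z ^ 2 ≤ c ^ 2 + 2 * c * Real.exp (-c) * (Real.exp z + Real.exp (-z)) := by
  have key : ∀ w : ℝ, 0 ≤ w → w ^ 2 ≤ c ^ 2 + 2 * c * Real.exp (w - c) := by
    intro w hw
    rcases le_total w c with h | h
    · have h1 : w ^ 2 ≤ c ^ 2 := by gcongr
      have h2 : 0 ≤ 2 * c * Real.exp (w - c) := by positivity
      linarith
    · have h1 := Real.quadratic_le_exp_of_nonneg (sub_nonneg.2 h)
      have h2 : 2 * c * (1 + (w - c) + (w - c) ^ 2 / 2) ≤ 2 * c * Real.exp (w - c) := by gcongr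
      nlinarith [sq_nonneg (w - c)]
  have h1 := key |z| (abs_nonneg z)
  rw [sq_abs] at h1
  refine h1.trans ?_
  have h2 : Real.exp |z| ≤ Real.exp z + Real.exp (-z) := by
    rcases abs_cases z with ⟨h, _⟩ | ⟨h, _⟩ <;> rw [h] <;>
      linarith [Real.exp_pos z, Real.exp_pos (-z)]
  rw [sub_eq_add_neg, Real.exp_add]
  have h3 := mul_le_mul_of_nonneg_left h2 (by positivity : 0 ≤ 2 * c * Real.exp (-c))
  linarith

lemma SmoothLoss.nonneg {d : ℕ} {Ξ : Type*} {l : EuclideanSpace ℝ (Fin d) → Ξ → ℝ} {G L : ℝ}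
    (h : SmoothLoss l G L) (hd : 0 < d) (ξ : Ξ) : 0 ≤ G := by
  have h1 := (abs_nonneg _).trans (h.lipschitz ξ (EuclideanSpace.single ⟨0, hd⟩ 1) 0)
  simpa using h1

lemma SmoothLoss.hasGradientAt {d : ℕ} {Ξ : Type*} {l : EuclideanSpace ℝ (Fin d) → Ξ → ℝ} {G L : ℝ}
    (h : SmoothLoss l G L) (ξ : Ξ) (x : EuclideanSpace ℝ (Fin d)) :
    HasGradientAt (fun z => l z ξ) (gradient (fun z => l z ξ) x) x :=
  (h.differentiable ξ x).hasGradientAt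

lemma SmoothLoss.norm_gradient_le {d : ℕ} {Ξ : Type*} {l : EuclideanSpace ℝ (Fin d) → Ξ → ℝ}
    {G L : ℝ} (h : SmoothLoss l G L) (hd : 0 < d) (ξ : Ξ) (x : EuclideanSpace ℝ (Fin d)) :
    ‖gradient (fun z => l z ξ) x‖ ≤ G := by
  have hG := h.nonneg hd ξ
  have hlip : LipschitzWith ⟨G, hG⟩ (fun z => l z ξ) :=
    LipschitzWith.of_dist_le_mul fun a b => by
      rw [Real.dist_eq, dist_eq_norm]
      exact h.lipschitz ξ a b
  have h1 := norm_fderiv_le_of_lipschitz ℝ hlip (x₀ := x)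
  unfold gradient
  rw [LinearIsometryEquiv.norm_map]
  exact h1

section Batch

variable {d m : ℕ} {Ξ : Type*} [MeasurableSpace Ξ]

lemma supNorm_sq_le_of_forall {x : EuclideanSpace ℝ (Fin d)} {b : ℝ} (hb : 0 ≤ b)
    (h : ∀ i, x i ^ 2 ≤ b) : supNorm x ^ 2 ≤ b := by
  have h1 : supNorm x ≤ Real.sqrt b :=
    (pi_norm_le_iff_of_nonneg (Real.sqrt_nonneg b)).2 fun i => Real.abs_le_sqrt (h i)
  calc supNorm x ^ 2 ≤ Real.sqrt b ^ 2 := by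
        have := supNorm_nonneg x
        gcongr
    _ = b := Real.sq_sqrt hb

/-- The total noise of a mini-batch has squared `ℓ_∞` norm of order `m G² ln d`: the maximum of the
`d` sub-Gaussian coordinates is controlled by their exponential moments at the optimal `λ`. -/
theorem integral_supNorm_sum_linearNoise_le (hd : 2 ≤ d) (hm : 0 < m) (μ : Measure Ξ)
    [IsProbabilityMeasure μ] {v : Ξ → EuclideanSpace ℝ (Fin d)} (hv : Measurable v) {G : ℝ}
    (hG : ∀ ξ, ‖v ξ‖ ≤ G) :
    Integrable (fun s : Fin m → (Fin d → ℝ) × Ξ => supNorm (∑ j, linearNoise μ v (s j)) ^ 2)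
      (Measure.pi fun _ => sampleLaw d μ) ∧
    ∫ s, supNorm (∑ j, linearNoise μ v (s j)) ^ 2 ∂(Measure.pi fun _ : Fin m => sampleLaw d μ) ≤
      4 * m * G ^ 2 * (Real.log (2 * d) + 1) := by
  have hΞ : Nonempty Ξ := μ.nonempty_of_neZero
  have hG0 : 0 ≤ G := (norm_nonneg _).trans (hG hΞ.some)
  rcases hG0.eq_or_lt with rfl | hGpos
  · have hv0 : v = fun _ => 0 := funext fun ξ => norm_le_zero_iff.1 (hG ξ)
    simp [hv0, linearNoise, supNorm]
  have hm' : (0 : ℝ) < m := by exact_mod_cast hm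
  have hd' : (2 : ℝ) ≤ d := by exact_mod_cast hd
  set M := Real.log (2 * d) with hM
  have hM1 : 1 ≤ M := by
    rw [hM, Real.le_log_iff_exp_le (by linarith)]
    linarith [Real.exp_one_lt_d9]
  have hexpM : Real.exp M = 2 * d := Real.exp_log (by linarith)
  -- `lam ^ 2 * (m * G ^ 2) = M` is the optimal choice of the exponent
  set lam := Real.sqrt (M / (m * G ^ 2)) with hlam
  have hlamsq : lam ^ 2 = M / (m * G ^ 2) := Real.sq_sqrt (by positivity)
  have hlampos : 0 < lam := Real.sqrt_pos.2 (by positivity)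
  set c := 2 * M with hc
  have hc1 : 1 ≤ c := by linarith
  set N : (Fin m → (Fin d → ℝ) × Ξ) → EuclideanSpace ℝ (Fin d) :=
    fun s => ∑ j, linearNoise μ v (s j) with hN
  have hmeasN : Measurable N := by
    refine Finset.measurable_fun_sum _ fun j _ => ?_
    exact (measurable_linearNoise μ hv).comp (measurable_pi_apply j)
  -- the exponential moments of the coordinates of the sum
  have hexp : ∀ (i : Fin d) (t : ℝ) (s : Fin m → (Fin d → ℝ) × Ξ),
      Real.exp (t * N s i) = ∏ j, Real.exp (t * linearNoise μ v (s j) i) := by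
    intro i t s
    rw [← Real.exp_sum, ← Finset.mul_sum, hN]
    simp
  have hint : ∀ (i : Fin d) (t : ℝ), Integrable (fun s => Real.exp (t * N s i))
      (Measure.pi fun _ : Fin m => sampleLaw d μ) := by
    intro i t
    simp only [hexp]
    exact Integrable.fintype_prod fun j => integrable_exp_linearNoise μ hv hG i t
  have hle : ∀ (i : Fin d) (t : ℝ), t ^ 2 = lam ^ 2 →
      ∫ s, Real.exp (t * N s i) ∂(Measure.pi fun _ : Fin m => sampleLaw d μ) ≤ Real.exp M := by
    intro i t ht
    simp only [hexp]
    rw [integral_fintype_prod_eq_prod (f := fun (_ : Fin m) (p : (Fin d → ℝ) × Ξ) =>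
      Real.exp (t * linearNoise μ v p i)), Finset.prod_const, Finset.card_univ, Fintype.card_fin]
    calc _ ≤ Real.exp (t ^ 2 * G ^ 2) ^ m := by
          refine pow_le_pow_left₀ (integral_nonneg fun p => (Real.exp_pos _).le) ?_ m
          exact integral_exp_linearNoise_le μ hv hG i t
      _ = Real.exp M := by
          rw [← Real.exp_nat_mul, ht, hlamsq]
          congr 1
          field_simp
  have hint2 : ∀ i ∈ Finset.univ, Integrable (fun s => Real.exp (lam * N s i) +
      Real.exp (-lam * N s i)) (Measure.pi fun _ : Fin m => sampleLaw d μ) :=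
    fun i _ => (hint i lam).add (hint i (-lam))
  set Φ : (Fin m → (Fin d → ℝ) × Ξ) → ℝ := fun s => (c ^ 2 + 2 * c * Real.exp (-c) *
    ∑ i, (Real.exp (lam * N s i) + Real.exp (-lam * N s i))) / lam ^ 2 with hΦ
  have hΦint : Integrable Φ (Measure.pi fun _ : Fin m => sampleLaw d μ) := by
    refine Integrable.div_const (Integrable.add (integrable_const _) (Integrable.const_mul ?_ _)) _
    exact integrable_finsetSum _ hint2
  have hpt : ∀ s, supNorm (N s) ^ 2 ≤ Φ s := by
    intro s
    refine supNorm_sq_le_of_forall (by positivity) fun i => ?_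
    rw [hΦ, le_div_iff₀ (by positivity)]
    have h1 := sq_le_add_exp (z := lam * N s i) hc1
    have h2 : Real.exp (lam * N s i) + Real.exp (-lam * N s i) ≤
        ∑ i, (Real.exp (lam * N s i) + Real.exp (-lam * N s i)) :=
      Finset.single_le_sum (f := fun i => Real.exp (lam * N s i) + Real.exp (-lam * N s i))
        (fun i _ => by positivity) (Finset.mem_univ i)
    have h3 : 2 * c * Real.exp (-c) * (Real.exp (lam * N s i) + Real.exp (-lam * N s i)) ≤ _ :=
      mul_le_mul_of_nonneg_left h2 (by positivity)
    rw [← neg_mul lam, mul_pow] at h1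
    linarith
  have hNint : Integrable (fun s => supNorm (N s) ^ 2)
      (Measure.pi fun _ : Fin m => sampleLaw d μ) := by
    refine hΦint.mono' ?_ (Filter.Eventually.of_forall fun s => ?_)
    · exact ((continuous_supNorm.measurable.comp hmeasN).pow_const 2).aestronglyMeasurable
    · rw [Real.norm_of_nonneg (sq_nonneg _)]
      exact hpt s
  refine ⟨hNint, (integral_mono hNint hΦint hpt).trans ?_⟩
  have hsum : ∫ s, (∑ i, (Real.exp (lam * N s i) + Real.exp (-lam * N s i)))
      ∂(Measure.pi fun _ : Fin m => sampleLaw d μ) ≤ Real.exp M * Real.exp M := by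
    rw [integral_finsetSum _ hint2]
    calc _ ≤ ∑ _i : Fin d, 2 * Real.exp M := by
          refine Finset.sum_le_sum fun i _ => ?_
          rw [integral_add (hint i lam) (hint i (-lam))]
          linarith [hle i lam rfl, hle i (-lam) (neg_sq lam)]
      _ = _ := by
          rw [Finset.sum_const, Finset.card_univ, Fintype.card_fin, nsmul_eq_mul]
          nth_rw 2 [hexpM]
          ring
  rw [hΦ, integral_div, integral_add (integrable_const _) (Integrable.const_mul
    (integrable_finsetSum _ hint2) _), integral_const_mul]
  simp only [integral_const, probReal_univ, one_smul]
  have h1 := mul_le_mul_of_nonneg_left hsum (by positivity : 0 ≤ 2 * c * Real.exp (-c))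
  have h2 : 2 * c * Real.exp (-c) * (Real.exp M * Real.exp M) = 2 * c := by
    rw [← Real.exp_add, mul_assoc, ← Real.exp_add, hc, show -(2 * M) + (M + M) = 0 by ring,
      Real.exp_zero, mul_one]
  rw [h2] at h1
  calc _ ≤ (c ^ 2 + 2 * c) / lam ^ 2 := by gcongr
    _ = 4 * m * G ^ 2 * (M + 1) := by
        rw [hlamsq, hc]
        field_simp
        ring

/-- Stochastic gradients are measurable, as limits of difference quotients. -/
lemma SmoothLoss.measurable_gradient {l : EuclideanSpace ℝ (Fin d) → Ξ → ℝ} {G L : ℝ}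
    (h : SmoothLoss l G L) (hl : ∀ x, Measurable (l x)) (x : EuclideanSpace ℝ (Fin d)) :
    Measurable fun ξ => gradient (fun z => l z ξ) x := by
  have hcoord : ∀ i, Measurable fun ξ => gradient (fun z => l z ξ) x i := by
    intro i
    refine measurable_of_tendsto_metrizable (f := fun (n : ℕ) ξ =>
      (n : ℝ) • (l (x + (n : ℝ)⁻¹ • EuclideanSpace.single i (1 : ℝ)) ξ - l x ξ))
      (fun n => by
        have h1 := hl (x + (n : ℝ)⁻¹ • EuclideanSpace.single i (1 : ℝ))
        have h2 := hl x
        fun_prop) (tendsto_pi_nhds.2 fun ξ => ?_)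
    have h1 := ((h.hasGradientAt ξ x).hasFDerivAt.lim_real
      (EuclideanSpace.single i (1 : ℝ))).comp tendsto_natCast_atTop_atTop
    rw [InnerProductSpace.toDual_apply_apply, EuclideanSpace.inner_single_right] at h1
    simpa [Function.comp_def] using h1
  have h2 : Measurable fun ξ => WithLp.ofLp (gradient (fun z => l z ξ) x) :=
    measurable_pi_iff.2 hcoord
  exact (PiLp.continuous_toLp 2 _).measurable.comp h2

lemma SmoothLoss.integrable_gradient {l : EuclideanSpace ℝ (Fin d) → Ξ → ℝ} {G L : ℝ}
    (h : SmoothLoss l G L) (hd : 0 < d) (hl : ∀ x, Measurable (l x)) (μ : Measure Ξ)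
    [IsProbabilityMeasure μ] (x : EuclideanSpace ℝ (Fin d)) :
    Integrable (fun ξ => gradient (fun z => l z ξ) x) μ :=
  integrable_of_norm_le μ (h.measurable_gradient hl x) fun ξ => h.norm_gradient_le hd ξ x

lemma SmoothLoss.norm_gradient_meanLoss_sub_le {l : EuclideanSpace ℝ (Fin d) → Ξ → ℝ} {G L : ℝ}
    (h : SmoothLoss l G L) (hd : 0 < d) {μ : Measure Ξ} [IsProbabilityMeasure μ]
    (hu : UnbiasedGradient l μ) (x y : EuclideanSpace ℝ (Fin d)) :
    ‖gradient (meanLoss l μ) x - gradient (meanLoss l μ) y‖ ≤ L * ‖x - y‖ := by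
  rw [(hu.unbiased x).gradient, (hu.unbiased y).gradient,
    ← integral_sub (h.integrable_gradient hd hu.measurable μ x)
      (h.integrable_gradient hd hu.measurable μ y)]
  refine (norm_integral_le_of_norm_le_const (C := L * ‖x - y‖)
    (Filter.Eventually.of_forall fun ξ => h.smooth ξ x y)).trans_eq ?_
  simp

lemma SmoothLoss.continuous_gradient_meanLoss {l : EuclideanSpace ℝ (Fin d) → Ξ → ℝ} {G L : ℝ}
    (h : SmoothLoss l G L) (hd : 0 < d) {μ : Measure Ξ} [IsProbabilityMeasure μ]
    (hu : UnbiasedGradient l μ) : Continuous (gradient (meanLoss l μ)) := by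
  have hlip : LipschitzWith (Real.toNNReal L) (gradient (meanLoss l μ)) :=
    LipschitzWith.of_dist_le_mul fun a b => by
      rw [dist_eq_norm, dist_eq_norm]
      refine (h.norm_gradient_meanLoss_sub_le hd hu a b).trans ?_
      gcongr
      exact Real.le_coe_toNNReal L
  exact hlip.continuous

lemma measurable_batchGradient {l : EuclideanSpace ℝ (Fin d) → Ξ → ℝ} {G L : ℝ}
    (h : SmoothLoss l G L) (hl : ∀ x, Measurable (l x)) (ν : ℝ) :
    Measurable fun p : EuclideanSpace ℝ (Fin d) × (Fin m → (Fin d → ℝ) × Ξ) =>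
      batchGradient l ν p.1 p.2 := by
  have hunc : Measurable (Function.uncurry l) :=
    measurable_uncurry_of_continuous_of_measurable (fun ξ => (h.differentiable ξ).continuous) hl
  unfold batchGradient
  refine Measurable.fun_const_smul (M := ℝ)
    (Finset.measurable_fun_sum (M := EuclideanSpace ℝ (Fin d)) Finset.univ fun j _ => ?_) _
  have hs : Measurable fun p : EuclideanSpace ℝ (Fin d) × (Fin m → (Fin d → ℝ) × Ξ) => p.2 j :=
    (measurable_pi_apply j).comp measurable_snd
  have hu : Measurable fun p : EuclideanSpace ℝ (Fin d) × (Fin m → (Fin d → ℝ) × Ξ) =>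
      (WithLp.toLp 2 (p.2 j).1 : EuclideanSpace ℝ (Fin d)) :=
    (PiLp.continuous_toLp 2 _).measurable.comp hs.fst
  have hx : Measurable fun p : EuclideanSpace ℝ (Fin d) × (Fin m → (Fin d → ℝ) × Ξ) => p.1 :=
    measurable_fst
  have hxu : Measurable fun p : EuclideanSpace ℝ (Fin d) × (Fin m → (Fin d → ℝ) × Ξ) =>
      p.1 + ν • (WithLp.toLp 2 (p.2 j).1 : EuclideanSpace ℝ (Fin d)) := by fun_prop
  have h1 := hunc.comp (hxu.prodMk hs.snd)
  have h2 := hunc.comp (hx.prodMk hs.snd)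
  exact (h1.sub h2).smul hu

/-- The estimator differs from the average of the linear parts by a multiple of each Rademacher
vector of size `L ν d / 2`, the error of the linearisation of the loss. -/
lemma supNorm_batchGradient_sub_sq_le {l : EuclideanSpace ℝ (Fin d) → Ξ → ℝ} {G L : ℝ}
    (h : SmoothLoss l G L) {μ : Measure Ξ} (hu : UnbiasedGradient l μ) (hm : 0 < m) {ν : ℝ}
    (hν : 0 < ν) (x : EuclideanSpace ℝ (Fin d)) {s : Fin m → (Fin d → ℝ) × Ξ}
    (hs : ∀ j i, (s j).1 i = 1 ∨ (s j).1 i = -1) :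
    supNorm (batchGradient l ν x s - gradient (meanLoss l μ) x) ^ 2 ≤
      2 / (m : ℝ) ^ 2 *
        supNorm (∑ j, linearNoise μ (fun ξ => gradient (fun z => l z ξ) x) (s j)) ^ 2 +
      (L * ν * d) ^ 2 / 2 := by
  have hm' : (0 : ℝ) < m := by exact_mod_cast hm
  set N := ∑ j, linearNoise μ (fun ξ => gradient (fun z => l z ξ) x) (s j) with hN
  set u : Fin m → EuclideanSpace ℝ (Fin d) := fun j => WithLp.toLp 2 (s j).1 with hudef
  set ρ : Fin m → ℝ := fun j => l (x + ν • u j) (s j).2 - l x (s j).2 -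
    inner ℝ (gradient (fun z => l z (s j).2) x) (ν • u j) with hρ
  have habs : ∀ j i, |(s j).1 i| = 1 := fun j i => by rcases hs j i with h | h <;> simp [h]
  have hρle : ∀ j, |ρ j| ≤ L / 2 * (ν ^ 2 * d) := by
    intro j
    have h1 := abs_sub_sub_inner_le (h.hasGradientAt (s j).2) (h.smooth (s j).2) x (x + ν • u j)
    rw [add_sub_cancel_left] at h1
    have h2 : ‖ν • u j‖ ^ 2 = ν ^ 2 * d := by
      rw [norm_smul, mul_pow, Real.norm_eq_abs, sq_abs, EuclideanSpace.real_norm_sq_eq]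
      congr 1
      calc ∑ i, (u j) i ^ 2 = ∑ _i : Fin d, (1 : ℝ) :=
            Finset.sum_congr rfl fun i _ => by rw [← sq_abs]; simp [hudef, habs]
        _ = d := by simp
    rw [h2] at h1
    exact h1
  have hdecomp : batchGradient l ν x s - gradient (meanLoss l μ) x =
      (1 / (m : ℝ)) • N + (1 / (m * ν)) • ∑ j, ρ j • u j := by
    have h1 : ∀ j, (l (x + ν • u j) (s j).2 - l x (s j).2) • u j =
        ν • (linearNoise μ (fun ξ => gradient (fun z => l z ξ) x) (s j) +
          gradient (meanLoss l μ) x) + ρ j • u j := by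
      intro j
      rw [(hu.unbiased x).gradient]
      simp only [linearNoise, hρ, inner_smul_right, hudef]
      module
    unfold batchGradient
    rw [Finset.sum_congr rfl fun j _ => h1 j, Finset.sum_add_distrib, ← Finset.smul_sum,
      Finset.sum_add_distrib, ← hN, Finset.sum_const, Finset.card_univ, Fintype.card_fin,
      ← Nat.cast_smul_eq_nsmul ℝ, smul_add, smul_smul, smul_add, smul_smul,
      show 1 / ((m : ℝ) * ν) * ν = 1 / m by field_simp,
      show 1 / (m : ℝ) * m = 1 by field_simp, one_smul]
    abel
  rw [hdecomp]
  refine supNorm_sq_le_of_forall (by positivity) fun i => ?_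
  have hrem : |(1 / (m * ν)) * ∑ j, ρ j * u j i| ≤ L * ν * d / 2 := by
    rw [abs_mul, abs_of_pos (by positivity)]
    have h2 : |∑ j, ρ j * u j i| ≤ m * (L / 2 * (ν ^ 2 * d)) := by
      refine (Finset.abs_sum_le_sum_abs _ _).trans ?_
      calc ∑ j, |ρ j * u j i| ≤ ∑ _j : Fin m, L / 2 * (ν ^ 2 * d) := by
            refine Finset.sum_le_sum fun j _ => ?_
            rw [abs_mul, show |u j i| = 1 from habs j i, mul_one]
            exact hρle j
        _ = _ := by simp
    calc _ ≤ 1 / (m * ν) * (m * (L / 2 * (ν ^ 2 * d))) := by gcongr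
      _ = _ := by field_simp
  have hNi : |N i| ≤ supNorm N := abs_apply_le_supNorm N i
  have hexpand : ((1 / (m : ℝ)) • N + (1 / (m * ν)) • ∑ j, ρ j • u j) i =
      1 / m * N i + (1 / (m * ν)) * ∑ j, ρ j * u j i := by
    simp
  rw [hexpand]
  set b := (1 / (m * ν)) * ∑ j, ρ j * u j i
  have h3 : b ^ 2 ≤ (L * ν * d / 2) ^ 2 := sq_le_sq' (by linarith [abs_le.1 hrem]) (abs_le.1 hrem).2
  have h4 : N i ^ 2 ≤ supNorm N ^ 2 := by
    rw [← sq_abs]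
    gcongr
  calc (1 / m * N i + b) ^ 2 ≤ 2 * ((1 / m * N i) ^ 2 + b ^ 2) := add_sq_le
    _ = 2 / m ^ 2 * N i ^ 2 + 2 * b ^ 2 := by ring
    _ ≤ 2 / m ^ 2 * supNorm N ^ 2 + 2 * (L * ν * d / 2) ^ 2 := by gcongr
    _ = _ := by ring

/-- The mean squared error of the mini-batch estimator in the `ℓ_∞` norm. -/
theorem lintegral_supNorm_batchGradient_sub_sq_le {l : EuclideanSpace ℝ (Fin d) → Ξ → ℝ} {G L : ℝ}
    (h : SmoothLoss l G L) {μ : Measure Ξ} [IsProbabilityMeasure μ] (hu : UnbiasedGradient l μ)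
    (hd : 2 ≤ d) (hm : 0 < m) {ν : ℝ} (hν : 0 < ν) (x : EuclideanSpace ℝ (Fin d)) :
    ∫⁻ s, ENNReal.ofReal (supNorm (batchGradient l ν x s - gradient (meanLoss l μ) x) ^ 2)
      ∂(Measure.pi fun _ : Fin m => sampleLaw d μ) ≤
    ENNReal.ofReal (8 * G ^ 2 * (Real.log (2 * d) + 1) / m + (L * ν * d) ^ 2 / 2) := by
  have hm' : (0 : ℝ) < m := by exact_mod_cast hm
  obtain ⟨hint, hle⟩ := integral_supNorm_sum_linearNoise_le hd hm μ
    (h.measurable_gradient hu.measurable x) (fun ξ => h.norm_gradient_le (by omega) ξ x)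
  set Q : (Fin m → (Fin d → ℝ) × Ξ) → ℝ := fun s => 2 / (m : ℝ) ^ 2 *
    supNorm (∑ j, linearNoise μ (fun ξ => gradient (fun z => l z ξ) x) (s j)) ^ 2 +
      (L * ν * d) ^ 2 / 2 with hQ
  have hQint : Integrable Q (Measure.pi fun _ : Fin m => sampleLaw d μ) :=
    (hint.const_mul _).add (integrable_const _)
  have hsign : ∀ᵐ s ∂(Measure.pi fun _ : Fin m => sampleLaw d μ),
      ∀ j i, (s j).1 i = 1 ∨ (s j).1 i = -1 := by
    rw [ae_all_iff]
    intro j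
    exact (measurePreserving_eval (fun _ : Fin m => sampleLaw d μ) j).quasiMeasurePreserving.ae
      (ae_sampleLaw μ)
  calc _ ≤ ∫⁻ s, ENNReal.ofReal (Q s) ∂(Measure.pi fun _ : Fin m => sampleLaw d μ) := by
        refine lintegral_mono_ae ?_
        filter_upwards [hsign] with s hs
        exact ENNReal.ofReal_le_ofReal (supNorm_batchGradient_sub_sq_le h hu hm hν x hs)
    _ = ENNReal.ofReal (∫ s, Q s ∂(Measure.pi fun _ : Fin m => sampleLaw d μ)) :=
        (ofReal_integral_eq_lintegral_ofReal hQint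
          (Filter.Eventually.of_forall fun s => by simp only [hQ]; positivity)).symm
    _ ≤ _ := by
        refine ENNReal.ofReal_le_ofReal ?_
        rw [hQ, integral_add (hint.const_mul _) (integrable_const _), integral_const_mul]
        simp only [integral_const, probReal_univ, one_smul]
        gcongr
        calc _ ≤ 2 / (m : ℝ) ^ 2 * (4 * m * G ^ 2 * (Real.log (2 * d) + 1)) := by gcongr
          _ = _ := by
            field_simp
            ring

end Batch

/-! ### Progress along a trajectory -/

section Step

variable {d : ℕ} {r : EuclideanSpace ℝ (Fin d) → ℝ} {K : Set (EuclideanSpace ℝ (Fin d))}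
  {F : EuclideanSpace ℝ (Fin d) → ℝ} {F' : EuclideanSpace ℝ (Fin d) → EuclideanSpace ℝ (Fin d)}
  {L D η : ℝ} {x g y z : EuclideanSpace ℝ (Fin d)}

/-- The decrease of the composite objective `F + r` in an inexact mirror step. -/
theorem IsMirrorMin.descent (hd : 0 < d) (hK : Convex ℝ K) (hr : ConvexOn ℝ Set.univ r)
    (hKD : ∀ x ∈ K, l1Norm x ≤ D) (hF : ∀ x, HasGradientAt F (F' x) x)
    (hL : ∀ x y, ‖F' x - F' y‖ ≤ L * ‖x - y‖) (hL0 : 0 ≤ L) (hη : 0 ≤ η) (hx : x ∈ K)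
    (h : IsMirrorMin entropyLike r K x g η y) :
    η * (l1Norm (y - x) ^ 2 / (D + 1)) ≤ (F x + r x) - (F y + r y) +
      supNorm (g - F' x) * l1Norm (y - x) + L / 2 * l1Norm (y - x) ^ 2 := by
  have h1 := h.l1Norm_sq_le hd hK hr hη hx (hKD x hx) (hKD y h.1)
  have h2 := (abs_le.1 (abs_sub_sub_inner_le hF hL x y)).2
  have h3 : L / 2 * ‖y - x‖ ^ 2 ≤ L / 2 * l1Norm (y - x) ^ 2 := by
    have := norm_le_l1Norm (y - x)
    gcongr
  have h4 := inner_le_supNorm_mul_l1Norm (g - F' x) (x - y)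
  rw [l1Norm_sub_comm x y] at h4
  rw [show inner ℝ (F' x) (y - x) = -inner ℝ (F' x) (x - y) by
    rw [← inner_neg_right, neg_sub]] at h2
  rw [inner_sub_left] at h4
  linarith

/-- The exact gradient map is controlled by the length of the inexact step and its error. -/
theorem l1Norm_smul_sub_le (hd : 0 < d) (hK : Convex ℝ K) (hr : ConvexOn ℝ Set.univ r)
    (hD : 0 ≤ D) (hKD : ∀ x ∈ K, l1Norm x ≤ D) (hη : 0 ≤ η) {g₀ : EuclideanSpace ℝ (Fin d)}
    (hy : IsMirrorMin entropyLike r K x g η y) (hz : IsMirrorMin entropyLike r K x g₀ η z) :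
    l1Norm ((η / (D + 1)) • (x - z)) ≤ η / (D + 1) * l1Norm (y - x) + supNorm (g - g₀) := by
  have hc : 0 ≤ η / (D + 1) := by positivity
  have h1 := hy.mul_l1Norm_sub_le hd hK hr hη hz (hKD _ hy.1) (hKD _ hz.1)
  have h2 : l1Norm (x - z) ≤ l1Norm (y - x) + l1Norm (y - z) := by
    have := l1Norm_add_le (x - y) (y - z)
    rwa [sub_add_sub_cancel, l1Norm_sub_comm x y] at this
  rw [l1Norm_smul, abs_of_nonneg hc]
  have h3 := mul_le_mul_of_nonneg_left h2 hc
  linarith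

end Step

/-- The per-iteration bound for the constant stepsize. Young's inequality is applied with unequal
weights, `(2Lδ + e)² ≤ 6L²δ² + 3e²`, to bring the coefficient of `L Δ` down to `6`. -/
lemma sq_le_of_descent_of_const_step {L δ e Δ g : ℝ} (hL : 0 < L) (hg0 : 0 ≤ g)
    (h : 2 * L * δ ^ 2 ≤ Δ + e * δ + L / 2 * δ ^ 2) (hg : g ≤ 2 * L * δ + e) :
    g ^ 2 ≤ 6 * L * Δ + 6 * e ^ 2 := by
  have h1 : g ^ 2 ≤ (2 * L * δ + e) ^ 2 := by gcongr
  have h2 := mul_le_mul_of_nonneg_left h (by positivity : 0 ≤ 6 * L)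
  nlinarith [sq_nonneg (L * δ - e)]

/-- Summation by parts with nondecreasing weights. -/
lemma sum_mul_sub_le {α f : ℕ → ℝ} {R : ℝ} {T : ℕ} (hα0 : 0 ≤ α 0)
    (hα : ∀ t < T, α t ≤ α (t + 1)) (hf : ∀ t ≤ T, f t ≤ R) :
    ∑ t ∈ Finset.range T, α t * (f t - f (t + 1)) ≤ α T * (R - f T) := by
  induction T with
  | zero =>
    simp only [Finset.range_zero, Finset.sum_empty]
    exact mul_nonneg hα0 (sub_nonneg.2 (hf 0 le_rfl))
  | succ n ih =>
    rw [Finset.sum_range_succ]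
    have h1 := ih (fun t ht => hα t (by omega)) fun t ht => hf t (by omega)
    have h2 := mul_le_mul_of_nonneg_right (hα n (by omega)) (sub_nonneg.2 (hf (n + 1) le_rfl))
    linarith

/-- The potential `√(1 + ∑ h²)` pays for `h min(2, h / β)`, where `β` is its current value. -/
lemma mul_le_sqrt_sub {b h δ D : ℝ} (hb : 0 < b) (hh : 0 ≤ h) (hD : 0 ≤ D)
    (hδ : δ * b ≤ (D + 1) * h) (hδD : δ ≤ 2 * D) :
    h * δ ≤ 4 * (D + 1) * (Real.sqrt (b ^ 2 + h ^ 2) - b) := by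
  set b' := Real.sqrt (b ^ 2 + h ^ 2) with hb'
  have hsq : b' ^ 2 = b ^ 2 + h ^ 2 := Real.sq_sqrt (by positivity)
  have hbb' : b ≤ b' := Real.le_sqrt_of_sq_le (by linarith [sq_nonneg h])
  rcases le_total h (2 * b) with hc | hc
  · have h1 : b' ≤ 3 * b := by
      refine Real.sqrt_le_iff.2 ⟨by positivity, ?_⟩
      nlinarith
    have h2 : h ^ 2 ≤ 4 * b * (b' - b) := by nlinarith
    refine le_of_mul_le_mul_right ?_ hb
    calc h * δ * b = h * (δ * b) := by ring
      _ ≤ h * ((D + 1) * h) := by gcongr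
      _ = (D + 1) * h ^ 2 := by ring
      _ ≤ (D + 1) * (4 * b * (b' - b)) := by gcongr
      _ = _ := by ring
  · have h1 : b + h / 2 ≤ b' := by
      refine Real.le_sqrt_of_sq_le ?_
      nlinarith
    calc h * δ ≤ h * (2 * D) := by gcongr
      _ ≤ 4 * (D + 1) * (h / 2) := by nlinarith
      _ ≤ _ := by
        gcongr
        linarith

/-- The total squared length of the steps taken with adaptive stepsizes. Each descent inequality is
multiplied by its stepsize `α t`; the objective values then sum by parts, and the curvature term
`L h δ` sums against the potential `√(1 + ∑ h²)`. -/
theorem sum_sq_le_of_adaptive_descent {α f h δ e : ℕ → ℝ} {R L D : ℝ} {T : ℕ} (hL : 0 ≤ L)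
    (hD : 1 ≤ D) (hR : 0 < R) (hR2 : 1 / 2 ≤ R ^ 2) (hα : ∀ t ≤ T, 0 < α t)
    (hmono : ∀ t < T, α t ≤ α (t + 1)) (hf : ∀ t ≤ T, f t ∈ Set.Icc 0 R)
    (hδ0 : ∀ t < T, 0 ≤ δ t) (hδ : ∀ t < T, δ t ≤ 2 * D)
    (hh : ∀ t < T, h t = α t / (D + 1) * δ t)
    (hlow : ∀ t ≤ T, 1 + ∑ s ∈ Finset.range t, h s ^ 2 ≤ α t ^ 2)
    (hup : α T ^ 2 ≤ 1 + (D + 1) ^ 2 * ∑ s ∈ Finset.range T, h s ^ 2)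
    (hstep : ∀ t < T, α t * (δ t ^ 2 / (D + 1)) ≤
      f t - f (t + 1) + e t * δ t + L / 2 * δ t ^ 2) :
    ∑ t ∈ Finset.range T, h t ^ 2 ≤
      8 * R ^ 2 + 4 * ∑ t ∈ Finset.range T, e t ^ 2 + 32 * L ^ 2 * D * (D + 1) := by
  have hD1 : 0 < D + 1 := by linarith
  have hh0 : ∀ t < T, 0 ≤ h t := fun t ht => by
    rw [hh t ht]
    have := (hα t ht.le).le
    have := hδ0 t ht
    positivity
  set S : ℕ → ℝ := fun t => ∑ s ∈ Finset.range t, h s ^ 2 with hS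
  have hS0 : ∀ t, 0 ≤ S t := fun t => Finset.sum_nonneg fun _ _ => sq_nonneg _
  set b : ℕ → ℝ := fun t => Real.sqrt (1 + S t) with hb
  have hb0 : ∀ t, 0 < b t := fun t => Real.sqrt_pos.2 (by linarith [hS0 t])
  have hbsq : ∀ t, b t ^ 2 = 1 + S t := fun t => Real.sq_sqrt (by linarith [hS0 t])
  have hbα : ∀ t ≤ T, b t ≤ α t := fun t ht => Real.sqrt_le_iff.2 ⟨(hα t ht).le, hlow t ht⟩
  set H := Real.sqrt (S T) with hH
  have hHsq : H ^ 2 = S T := Real.sq_sqrt (hS0 T)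
  have hH0 : 0 ≤ H := Real.sqrt_nonneg _
  -- one step, multiplied by `α t / (D + 1)`
  have h1 : ∀ t ∈ Finset.range T, h t ^ 2 ≤ α t * (f t - f (t + 1)) / (D + 1) +
      (h t ^ 2 / 4 + e t ^ 2) + 2 * L * (D + 1) * (b (t + 1) - b t) := by
    intro t ht
    have ht := Finset.mem_range.1 ht
    have e1 := mul_le_mul_of_nonneg_left (hstep t ht)
      (div_nonneg (hα t ht.le).le hD1.le)
    have e2 : h t * δ t ≤ 4 * (D + 1) * (Real.sqrt (b t ^ 2 + h t ^ 2) - b t) := by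
      refine mul_le_sqrt_sub (hb0 t) (hh0 t ht) (by linarith) ?_ (hδ t ht)
      have e3 : (D + 1) * h t = δ t * α t := by
        rw [hh t ht]
        field_simp
      rw [e3]
      exact mul_le_mul_of_nonneg_left (hbα t ht.le) (hδ0 t ht)
    have e4 : b t ^ 2 + h t ^ 2 = 1 + S (t + 1) := by
      rw [hbsq, hS]
      simp only [Finset.sum_range_succ]
      ring
    rw [e4] at e2
    have e5 : α t / (D + 1) * (α t * (δ t ^ 2 / (D + 1))) = h t ^ 2 := by
      rw [hh t ht]
      ring
    have e6 : α t / (D + 1) * (f t - f (t + 1) + e t * δ t + L / 2 * δ t ^ 2) =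
        α t * (f t - f (t + 1)) / (D + 1) + e t * h t + L / 2 * (h t * δ t) := by
      rw [hh t ht]
      ring
    rw [e5, e6] at e1
    have e7 := mul_le_mul_of_nonneg_left e2 (by positivity : 0 ≤ L / 2)
    have e8 : e t * h t ≤ h t ^ 2 / 4 + e t ^ 2 := by nlinarith [sq_nonneg (h t / 2 - e t)]
    simp only [hb]
    linarith
  have h2 := Finset.sum_le_sum h1
  rw [Finset.sum_add_distrib, Finset.sum_add_distrib, Finset.sum_add_distrib, ← Finset.sum_div,
    ← Finset.sum_div, ← Finset.mul_sum, Finset.sum_range_sub] at h2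
  have h3 := sum_mul_sub_le (hα 0 (Nat.zero_le _)).le hmono fun t ht => (hf t ht).2
  have h4 : α T ≤ 1 + (D + 1) * H := by
    refine (abs_le_of_sq_le_sq' ?_ (by positivity)).2
    have : (D + 1) ^ 2 * S T = ((D + 1) * H) ^ 2 := by rw [mul_pow, hHsq]
    nlinarith [mul_nonneg hD1.le hH0]
  have h5 : (∑ t ∈ Finset.range T, α t * (f t - f (t + 1))) / (D + 1) ≤ R / 2 + R * H := by
    rw [div_le_iff₀ hD1]
    calc _ ≤ α T * (R - f T) := h3
      _ ≤ α T * R := by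
        have := (hα T le_rfl).le
        have := (hf T le_rfl).1
        gcongr
        linarith
      _ ≤ (1 + (D + 1) * H) * R := by gcongr
      _ ≤ _ := by nlinarith
  have h6 : b T - b 0 ≤ H := by
    have e1 : b 0 = 1 := by simp [hb, hS]
    have e2 : b T ≤ 1 + H := by
      refine Real.sqrt_le_iff.2 ⟨by positivity, ?_⟩
      nlinarith
    linarith
  have h7 : 2 * L * (D + 1) * (b T - b 0) ≤ 2 * L * (D + 1) * H := by gcongr
  change S T ≤ _
  change S T ≤ _ + (S T / 4 + _) + _ at h2
  have h8 : R ≤ 2 * R ^ 2 := by nlinarith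
  have h9 : R * H ≤ S T / 4 + R ^ 2 := by nlinarith [sq_nonneg (H / 2 - R)]
  have h10 : 2 * L * (D + 1) * H ≤ S T / 4 + 4 * (L * (D + 1)) ^ 2 := by
    nlinarith [sq_nonneg (H / 2 - 2 * (L * (D + 1)))]
  have h11 : (L * (D + 1)) ^ 2 ≤ 2 * L ^ 2 * D * (D + 1) := by
    have : (D + 1) ^ 2 ≤ 2 * D * (D + 1) := by nlinarith
    calc (L * (D + 1)) ^ 2 = L ^ 2 * (D + 1) ^ 2 := by ring
      _ ≤ L ^ 2 * (2 * D * (D + 1)) := by gcongr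
      _ = _ := by ring
  have h12 : S T / 4 ≤ R / 2 + R ^ 2 + ∑ t ∈ Finset.range T, e t ^ 2 +
      4 * (L * (D + 1)) ^ 2 := by
    have h13 := h2.trans (add_le_add (add_le_add_left h5 _) (h7.trans h10))
    linarith only [h13, h9]
  linarith only [h12, h8, h11]

section Adaptive

variable {d : ℕ} (x : ℕ → EuclideanSpace ℝ (Fin d))

lemma adaptiveStep_sq (t : ℕ) : adaptiveStep x t ^ 2 =
    1 + ∑ s ∈ Finset.range t,
      (adaptiveWeight x s * adaptiveStep x s * l1Norm (x (s + 1) - x s)) ^ 2 := by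
  rw [adaptiveStep, Real.sq_sqrt (by positivity), add_comm, ← Fin.sum_univ_eq_sum_range
    (fun s => (adaptiveWeight x s * adaptiveStep x s * l1Norm (x (s + 1) - x s)) ^ 2)]
  simp only [mul_pow]

lemma adaptiveStep_pos (t : ℕ) : 0 < adaptiveStep x t := by
  rw [adaptiveStep]
  positivity

lemma adaptiveStep_le_succ (t : ℕ) : adaptiveStep x t ≤ adaptiveStep x (t + 1) := by
  refine (sq_le_sq₀ (adaptiveStep_pos x t).le (adaptiveStep_pos x (t + 1)).le).1 ?_
  rw [adaptiveStep_sq, adaptiveStep_sq, Finset.sum_range_succ]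
  linarith [sq_nonneg (adaptiveWeight x t * adaptiveStep x t * l1Norm (x (t + 1) - x t))]

lemma adaptiveWeight_le_one (t : ℕ) : adaptiveWeight x t ≤ 1 := by
  have h : 0 ≤ max (l1Norm (x t)) (l1Norm (x (t + 1))) := (l1Norm_nonneg _).trans (le_max_left _ _)
  unfold adaptiveWeight
  rw [div_le_one (by linarith)]
  linarith

lemma one_div_le_adaptiveWeight {D : ℝ} {t : ℕ} (h₁ : l1Norm (x t) ≤ D)
    (h₂ : l1Norm (x (t + 1)) ≤ D) : 1 / (D + 1) ≤ adaptiveWeight x t := by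
  have h : 0 ≤ max (l1Norm (x t)) (l1Norm (x (t + 1))) := (l1Norm_nonneg _).trans (le_max_left _ _)
  unfold adaptiveWeight
  gcongr
  exact max_le h₁ h₂

variable {x}

lemma one_add_sum_le_adaptiveStep_sq {D : ℝ} (hD : 0 ≤ D) {t : ℕ}
    (hx : ∀ s ≤ t, l1Norm (x s) ≤ D) :
    1 + ∑ s ∈ Finset.range t, (adaptiveStep x s / (D + 1) * l1Norm (x (s + 1) - x s)) ^ 2 ≤
      adaptiveStep x t ^ 2 := by
  rw [adaptiveStep_sq]
  refine add_le_add le_rfl (Finset.sum_le_sum fun s hs => ?_)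
  have hs := Finset.mem_range.1 hs
  have h0 := (adaptiveStep_pos x s).le
  have h1 := l1Norm_nonneg (x (s + 1) - x s)
  have h2 := one_div_le_adaptiveWeight x (hx s hs.le) (hx (s + 1) hs)
  refine pow_le_pow_left₀ (by positivity) (mul_le_mul_of_nonneg_right ?_ h1) 2
  rw [div_eq_mul_one_div, mul_comm]
  exact mul_le_mul_of_nonneg_right h2 h0

lemma adaptiveStep_sq_le {D : ℝ} (hD : 0 ≤ D) (t : ℕ) :
    adaptiveStep x t ^ 2 ≤ 1 + (D + 1) ^ 2 *
      ∑ s ∈ Finset.range t, (adaptiveStep x s / (D + 1) * l1Norm (x (s + 1) - x s)) ^ 2 := by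
  rw [adaptiveStep_sq, Finset.mul_sum]
  gcongr with s hs
  have h0 := (adaptiveStep_pos x s).le
  have h1 := l1Norm_nonneg (x (s + 1) - x s)
  have h2 : 0 ≤ adaptiveWeight x s := by
    unfold adaptiveWeight
    have := (l1Norm_nonneg _).trans (le_max_left (l1Norm (x s)) (l1Norm (x (s + 1))))
    positivity
  have h3 := adaptiveWeight_le_one x s
  calc (adaptiveWeight x s * adaptiveStep x s * l1Norm (x (s + 1) - x s)) ^ 2
      ≤ (1 * adaptiveStep x s * l1Norm (x (s + 1) - x s)) ^ 2 := by gcongr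
    _ = _ := by field_simp

end Adaptive

/-! ### Measurability and independence of the iterates -/

section Sampling

variable {d T m : ℕ} {Ω Ξ : Type*} [MeasurableSpace Ξ]
  {S : Fin T → Fin m → Ω → (Fin d → ℝ) × Ξ}

/-- The `σ`-algebra generated by the samples of the iterations before `t`. -/
@[reducible] def pastSigma (S : Fin T → Fin m → Ω → (Fin d → ℝ) × Ξ) (t : ℕ) : MeasurableSpace Ω :=
  ⨆ p ∈ {p : Fin T × Fin m | (p.1 : ℕ) < t}, MeasurableSpace.comap (S p.1 p.2) inferInstance

lemma pastSigma_mono : Monotone (pastSigma S) := fun _ _ hst =>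
  biSup_mono fun _ hp => lt_of_lt_of_le hp hst

lemma measurable_pastSigma {t : Fin T} {n : ℕ} (ht : (t : ℕ) < n) (j : Fin m) :
    Measurable[pastSigma S n] (S t j) :=
  measurable_iff_comap_le.2 (le_iSup₂_of_le (t, j) ht le_rfl)

lemma pastSigma_le_comap (n : ℕ) : pastSigma S n ≤
    MeasurableSpace.comap (fun ω (p : Fin T × Fin m) => S p.1 p.2 ω) inferInstance := by
  refine iSup₂_le fun p _ => ?_
  rintro _ ⟨s, hs, rfl⟩
  exact ⟨(fun q => q p) ⁻¹' s, measurable_pi_apply p hs, rfl⟩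

variable [MeasurableSpace Ω] {P : Measure Ω} {μ : Measure Ξ} {τ : Ω → Fin T}

lemma IsSampling.pastSigma_le (hS : IsSampling P μ S τ) (n : ℕ) :
    pastSigma S n ≤ (inferInstance : MeasurableSpace Ω) :=
  iSup₂_le fun p _ => measurable_iff_comap_le.1 (hS.measurable p.1 p.2)

/-- The samples of an iteration are independent of everything determined by the previous ones. -/
lemma IsSampling.indepFun (hS : IsSampling P μ S τ) (t : Fin T) {β : Type*} [MeasurableSpace β]
    {X : Ω → β} (hX : Measurable[pastSigma S t] X) :
    IndepFun X (fun ω j => S t j ω) P := by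
  have h := indep_iSup_of_disjoint
    (m := fun p : Fin T × Fin m => MeasurableSpace.comap (S p.1 p.2) inferInstance)
    (fun p => measurable_iff_comap_le.1 (hS.measurable p.1 p.2)) hS.indep
    (S := {p : Fin T × Fin m | (p.1 : ℕ) < t}) (T := {p | p.1 = t})
    (Set.disjoint_left.2 fun p (hp : (p.1 : ℕ) < t) (hq : p.1 = t) => by simp [hq] at hp)
  refine indep_of_indep_of_le_left (indep_of_indep_of_le_right h ?_)
    (measurable_iff_comap_le.1 hX)
  rw [MeasurableSpace.pi, MeasurableSpace.comap_iSup]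
  refine iSup_le fun j => ?_
  rw [MeasurableSpace.comap_comp]
  exact (le_iSup₂_of_le
    (f := fun (p : Fin T × Fin m) (_ : p ∈ {p : Fin T × Fin m | p.1 = t}) =>
      MeasurableSpace.comap (S p.1 p.2) inferInstance) (t, j) rfl le_rfl)

lemma IsSampling.map_batch [IsProbabilityMeasure P] (hS : IsSampling P μ S τ) (t : Fin T) :
    P.map (fun ω j => S t j ω) = Measure.pi fun _ : Fin m => sampleLaw d μ := by
  have h := hS.indep.precomp (g := fun j : Fin m => (t, j)) fun a b hab => (Prod.ext_iff.1 hab).2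
  have h2 := (iIndepFun_iff_map_fun_eq_pi_map
    (fun j => (hS.measurable t j).aemeasurable)).1 h
  refine h2.trans ?_
  congr 1
  funext j
  exact hS.law t j

/-- The mean squared error of the gradient estimate at an iterate determined by the past: by
independence, the iterate may be frozen. -/
theorem IsSampling.integral_supNorm_error_le [IsProbabilityMeasure P] [IsProbabilityMeasure μ]
    (hS : IsSampling P μ S τ)
    {l : EuclideanSpace ℝ (Fin d) → Ξ → ℝ} {G L : ℝ} (h : SmoothLoss l G L)
    (hu : UnbiasedGradient l μ) (hd : 2 ≤ d) (hm : 0 < m) {ν : ℝ} (hν : 0 < ν) (t : Fin T)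
    {X : Ω → EuclideanSpace ℝ (Fin d)} (hX : Measurable[pastSigma S t] X) {W : ℝ} (hW0 : 0 ≤ W)
    (hW : 8 * G ^ 2 * (Real.log (2 * d) + 1) / m + (L * ν * d) ^ 2 / 2 ≤ W) :
    Integrable (fun ω => supNorm (batchGradient l ν (X ω) (fun j => S t j ω) -
      gradient (meanLoss l μ) (X ω)) ^ 2) P ∧
    ∫ ω, supNorm (batchGradient l ν (X ω) (fun j => S t j ω) -
      gradient (meanLoss l μ) (X ω)) ^ 2 ∂P ≤ W := by
  have hXm : Measurable X := hX.mono (hS.pastSigma_le t) le_rfl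
  have hbm : Measurable fun ω (j : Fin m) => S t j ω :=
    measurable_pi_iff.2 fun j => hS.measurable t j
  set Q : EuclideanSpace ℝ (Fin d) × (Fin m → (Fin d → ℝ) × Ξ) → ℝ := fun p =>
    supNorm (batchGradient l ν p.1 p.2 - gradient (meanLoss l μ) p.1) ^ 2 with hQ
  have hgrad := (h.continuous_gradient_meanLoss (by omega) hu).measurable
  have hQm : Measurable Q := by
    have h1 : Measurable fun p : EuclideanSpace ℝ (Fin d) × (Fin m → (Fin d → ℝ) × Ξ) =>
        batchGradient l ν p.1 p.2 - gradient (meanLoss l μ) p.1 :=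
      (measurable_batchGradient h hu.measurable ν).sub (hgrad.comp measurable_fst)
    exact (continuous_supNorm.measurable.comp h1).pow_const 2
  have hpair : Measurable fun ω => (X ω, fun j => S t j ω) := hXm.prodMk hbm
  have hlin : ∫⁻ ω, ENNReal.ofReal (Q (X ω, fun j => S t j ω)) ∂P ≤ ENNReal.ofReal W := by
    have hmap := (hS.indepFun t hX).map_prod_eq_prod_map_map hXm.aemeasurable hbm.aemeasurable
    rw [hS.map_batch t] at hmap
    have : IsProbabilityMeasure (P.map X) := Measure.isProbabilityMeasure_map hXm.aemeasurable
    rw [← lintegral_map (f := fun p => ENNReal.ofReal (Q p)) hQm.ennreal_ofReal hpair, hmap,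
      lintegral_prod _ hQm.ennreal_ofReal.aemeasurable]
    calc _ ≤ ∫⁻ _x, ENNReal.ofReal W ∂(P.map X) := lintegral_mono fun y =>
          (lintegral_supNorm_batchGradient_sub_sq_le h hu hd hm hν y).trans
            (ENNReal.ofReal_le_ofReal hW)
      _ = _ := by simp
  have hmeas : Measurable fun ω => Q (X ω, fun j => S t j ω) := hQm.comp hpair
  have hnn : ∀ ω, 0 ≤ Q (X ω, fun j => S t j ω) := fun ω => sq_nonneg _
  refine ⟨⟨hmeas.aestronglyMeasurable, ?_⟩, ?_⟩
  · rw [hasFiniteIntegral_iff_ofReal (Filter.Eventually.of_forall hnn)]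
    exact hlin.trans_lt ENNReal.ofReal_lt_top
  · refine (integral_eq_lintegral_of_nonneg_ae (Filter.Eventually.of_forall hnn)
      hmeas.aestronglyMeasurable).trans_le ?_
    exact ENNReal.toReal_le_of_le_ofReal hW0 hlin

/-- The expectation at the random output index is the average over the iterations. -/
theorem IsSampling.integral_index [IsProbabilityMeasure P] (hS : IsSampling P μ S τ)
    {Z : Fin T → Ω → ℝ} (hZ : ∀ t, Measurable[pastSigma S T] (Z t)) (hint : ∀ t, Integrable (Z t) P) :
    Integrable (fun ω => Z (τ ω) ω) P ∧
      ∫ ω, Z (τ ω) ω ∂P = (∑ t, ∫ ω, Z t ω ∂P) / T := by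
  set I : Fin T → Fin T → ℝ := fun t s => if s = t then 1 else 0 with hI
  have hsum : (fun ω => Z (τ ω) ω) = fun ω => ∑ t, I t (τ ω) * Z t ω := by
    funext ω
    simp [hI]
  have hIm : ∀ t, Measurable (I t) := fun t => measurable_of_countable _
  have hind : ∀ t, IndepFun (fun ω => I t (τ ω)) (Z t) P := by
    intro t
    have h1 : IndepFun τ (Z t) P := indep_of_indep_of_le_right hS.index_indep
      (measurable_iff_comap_le.1 ((hZ t).mono (pastSigma_le_comap T) le_rfl))
    exact h1.comp (hIm t) measurable_id
  have hIint : ∀ t, Integrable (fun ω => I t (τ ω)) P := fun t =>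
    Integrable.of_bound ((hIm t).comp hS.index_measurable).aestronglyMeasurable 1
      (Filter.Eventually.of_forall fun ω => by
        simp only [hI]
        split_ifs <;> simp)
  have hIval : ∀ t, ∫ ω, I t (τ ω) ∂P = 1 / T := by
    intro t
    have h1 : (fun ω => I t (τ ω)) = (τ ⁻¹' {t}).indicator 1 := by
      funext ω
      by_cases hω : τ ω = t <;> simp [hI, hω, Set.indicator]
    rw [h1, integral_indicator_one (hS.index_measurable (measurableSet_singleton t)),
      Measure.real, hS.index_law t]
    simp
  have hprod : ∀ t, Integrable (fun ω => I t (τ ω) * Z t ω) P := fun t =>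
    (hind t).integrable_mul (hIint t) (hint t)
  rw [hsum]
  refine ⟨integrable_finsetSum _ fun t _ => hprod t, ?_⟩
  rw [integral_finsetSum _ fun t _ => hprod t, Finset.sum_div]
  refine Finset.sum_congr rfl fun t _ => ?_
  rw [(hind t).integral_fun_mul_eq_mul_integral (hIint t).aestronglyMeasurable
    (hint t).aestronglyMeasurable, hIval t]
  ring

end Sampling

lemma measurable_adaptiveStep {d : ℕ} {Ω : Type*} {mΩ : MeasurableSpace Ω}
    {x : ℕ → Ω → EuclideanSpace ℝ (Fin d)} (t : ℕ) (hx : ∀ s ≤ t, Measurable (x s)) :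
    Measurable fun ω => adaptiveStep (fun s => x s ω) t := by
  induction t using Nat.strong_induction_on with
  | _ t ih =>
    have h : (fun ω => adaptiveStep (fun s => x s ω) t) = fun ω => Real.sqrt (∑ s : Fin t,
        adaptiveWeight (fun s => x s ω) s ^ 2 * adaptiveStep (fun s => x s ω) s ^ 2 *
          l1Norm (x (s + 1) ω - x s ω) ^ 2 + 1) := by
      funext ω
      rw [adaptiveStep]
    rw [h]
    have hn : ∀ s ≤ t, Measurable fun ω => l1Norm (x s ω) := fun s hs =>
      continuous_l1Norm.measurable.comp (hx s hs)
    refine Measurable.sqrt ((Finset.measurable_fun_sum _ fun s _ => ?_).add_const 1)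
    have h1 := ih s s.2 fun k hk => hx k (by omega)
    have h2 : Measurable fun ω => adaptiveWeight (fun s => x s ω) s :=
      (((hn s s.2.le).max (hn (s + 1) s.2)).add_const 1).const_div 1
    have h3 : Measurable fun ω => l1Norm (x (s + 1) ω - x s ω) :=
      continuous_l1Norm.measurable.comp ((hx _ s.2).sub (hx _ s.2.le))
    exact ((h2.pow_const 2).mul (h1.pow_const 2)).mul (h3.pow_const 2)

/-! ### Expected stationarity of a run -/

/-- The standing assumptions on the composite part of the problem in usable form: a convex
function `r`, and a nonempty compact convex set `K` in the `ℓ₁` ball of radius `D`. -/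
structure MirrorDomain {d : ℕ} (r : EuclideanSpace ℝ (Fin d) → ℝ)
    (K : Set (EuclideanSpace ℝ (Fin d))) (D : ℝ) : Prop where
  nonempty : K.Nonempty
  isCompact : IsCompact K
  convex : Convex ℝ K
  convexOn : ConvexOn ℝ Set.univ r
  l1Norm_le : ∀ x ∈ K, l1Norm x ≤ D

lemma MirrorDomain.nonneg {d : ℕ} {r : EuclideanSpace ℝ (Fin d) → ℝ}
    {K : Set (EuclideanSpace ℝ (Fin d))} {D : ℝ} (h : MirrorDomain r K D) : 0 ≤ D :=
  (l1Norm_nonneg _).trans (h.l1Norm_le _ h.nonempty.some_mem)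

lemma MirrorDomain.continuous {d : ℕ} {r : EuclideanSpace ℝ (Fin d) → ℝ}
    {K : Set (EuclideanSpace ℝ (Fin d))} {D : ℝ} (h : MirrorDomain r K D) : Continuous r :=
  h.convexOn.locallyLipschitz.continuous

section Run

variable {d T m : ℕ} {Ω Ξ : Type*} {l : EuclideanSpace ℝ (Fin d) → Ξ → ℝ}
  {r : EuclideanSpace ℝ (Fin d) → ℝ} {K : Set (EuclideanSpace ℝ (Fin d))} {D ν : ℝ}
  {S : Fin T → Fin m → Ω → (Fin d → ℝ) × Ξ} {η : ℕ → Ω → ℝ} {x₁ : EuclideanSpace ℝ (Fin d)}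
  {x : ℕ → Ω → EuclideanSpace ℝ (Fin d)}

lemma IsRun.isMirrorMin (h : IsRun l r K ν S η x₁ x) (hd : 0 < d) (hK : MirrorDomain r K D)
    (t : Fin T) (ω : Ω) : IsMirrorMin entropyLike r K (x t ω)
      (batchGradient l ν (x t ω) fun j => S t j ω) (η t ω) (x (t + 1) ω) := by
  rw [h.step]
  exact isMirrorMin_genProj hd hK.isCompact hK.nonempty hK.continuous _ _ _

lemma IsRun.mem (h : IsRun l r K ν S η x₁ x) (hd : 0 < d) (hK : MirrorDomain r K D) (hx₁ : x₁ ∈ K)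
    {t : ℕ} (ht : t ≤ T) (ω : Ω) : x t ω ∈ K := by
  cases t with
  | zero =>
    rw [h.init]
    exact hx₁
  | succ n => exact (h.isMirrorMin hd hK ⟨n, ht⟩ ω).1

lemma oracleCalls_eq (ω : Ω) : oracleCalls ν S x ω = T * (2 * m) := by
  have h : ∀ (y : EuclideanSpace ℝ (Fin d)) (s : Fin m → (Fin d → ℝ) × Ξ),
      (queries ν y s).length = 2 * m := by
    intro y s
    simp [queries, List.length_flatMap, mul_comm]
  simp [oracleCalls, h]

/-- The estimation error `‖d_t - ∇l(x_t)‖_∞`, as a function on all of `ℕ` that vanishes from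
`t = T` on, where there are no samples. -/
def estimationError [MeasurableSpace Ξ] (l : EuclideanSpace ℝ (Fin d) → Ξ → ℝ) (μ : Measure Ξ)
    (ν : ℝ) (S : Fin T → Fin m → Ω → (Fin d → ℝ) × Ξ) (x : ℕ → Ω → EuclideanSpace ℝ (Fin d))
    (t : ℕ) (ω : Ω) : ℝ :=
  if ht : t < T then supNorm (batchGradient l ν (x t ω) (fun j => S ⟨t, ht⟩ j ω) -
    gradient (meanLoss l μ) (x t ω)) else 0

/-- The squared `ℓ₁` norm of the generalised gradient map at the `t`-th iterate. -/
def iterateStationarity [MeasurableSpace Ξ] (l : EuclideanSpace ℝ (Fin d) → Ξ → ℝ) (μ : Measure Ξ)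
    (r : EuclideanSpace ℝ (Fin d) → ℝ) (K : Set (EuclideanSpace ℝ (Fin d))) (D : ℝ)
    (η : ℕ → Ω → ℝ) (x : ℕ → Ω → EuclideanSpace ℝ (Fin d)) (t : ℕ) (ω : Ω) : ℝ :=
  l1Norm ((η t ω / (D + 1)) • (x t ω -
    genProj entropyLike r K (x t ω) (gradient (meanLoss l μ) (x t ω)) (η t ω))) ^ 2

variable [MeasurableSpace Ξ] {μ : Measure Ξ}

lemma stationarity_eq_iterateStationarity (hd : 0 < d) (hD : 0 ≤ D) {τ : Ω → Fin T} :
    stationarity l μ r K D η x τ =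
      fun ω => iterateStationarity l μ r K D η x (τ ω) ω := by
  funext ω
  unfold stationarity iterateStationarity
  rw [gradMap_const_mul_entropyLike hd (by positivity)]

lemma measurable_batchStep {mΩ : MeasurableSpace Ω} (hd : 0 < d) (hK : MirrorDomain r K D)
    {G L : ℝ} (hl : SmoothLoss l G L) (hlm : ∀ x, Measurable (l x))
    {X : Ω → EuclideanSpace ℝ (Fin d)} {s : Fin m → Ω → (Fin d → ℝ) × Ξ} {c : Ω → ℝ}
    (hX : Measurable X) (hs : ∀ j, Measurable (s j)) (hc : Measurable c) (hpos : ∀ ω, 0 < c ω) :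
    Measurable fun ω => genProj entropyLike r K (X ω)
      (batchGradient l ν (X ω) fun j => s j ω) (c ω) := by
  have hp : Measurable fun ω => (X ω, fun j => s j ω) := hX.prodMk (measurable_pi_lambda _ hs)
  have hg := (measurable_batchGradient hl hlm ν).comp hp
  simp only [Function.comp_def] at hg
  exact measurable_genProj hd hK.isCompact hK.nonempty hK.convex hK.convexOn hK.continuous
    hK.nonneg hK.l1Norm_le hX hg hc hpos

lemma measurable_iterateStationarity {mΩ : MeasurableSpace Ω} [IsProbabilityMeasure μ]
    (hd : 0 < d) (hK : MirrorDomain r K D) {G L : ℝ} (hl : SmoothLoss l G L)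
    (hu : UnbiasedGradient l μ) {t : ℕ} (hx : Measurable (x t)) (hη : Measurable (η t))
    (hpos : ∀ ω, 0 < η t ω) : Measurable (iterateStationarity l μ r K D η x t) := by
  have hgrad := (hl.continuous_gradient_meanLoss hd hu).measurable
  have h1 := measurable_genProj hd hK.isCompact hK.nonempty hK.convex hK.convexOn hK.continuous
    hK.nonneg hK.l1Norm_le hx (hgrad.comp hx) hη hpos
  exact (continuous_l1Norm.measurable.comp ((hη.div_const (D + 1)).smul (hx.sub h1))).pow_const 2

/-- The iterates are determined by the past samples, provided that the stepsizes are determined by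
the iterates. -/
lemma IsRun.measurable (h : IsRun l r K ν S η x₁ x) (hd : 0 < d) (hK : MirrorDomain r K D)
    {G L : ℝ} (hl : SmoothLoss l G L) (hlm : ∀ x, Measurable (l x)) (hpos : ∀ t ω, 0 < η t ω)
    (hη : ∀ t < T, ∀ m₀ : MeasurableSpace Ω, (∀ s ≤ t, Measurable[m₀] (x s)) →
      Measurable[m₀] (η t)) {t : ℕ} (ht : t ≤ T) : Measurable[pastSigma S t] (x t) := by
  induction t using Nat.strong_induction_on with
  | _ t ih =>
    cases t with
    | zero =>
      rw [show x 0 = fun _ => x₁ from funext h.init]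
      exact measurable_const
    | succ n =>
      have hx : ∀ s ≤ n, Measurable[pastSigma S (n + 1)] (x s) := fun s hs =>
        (ih s (by omega) (by omega)).mono (pastSigma_mono (by omega)) le_rfl
      rw [show x (n + 1) = _ from funext (h.step ⟨n, ht⟩)]
      exact measurable_batchStep (mΩ := pastSigma S (n + 1)) hd hK hl hlm (hx n le_rfl)
        (measurable_pastSigma (t := ⟨n, ht⟩) (Nat.lt_succ_self n)) (hη n ht _ hx) (hpos n)

/-- From a bound along all trajectories on the sum of the stationarity measures, in terms of the
estimation errors, to the expected stationarity at the random output index. -/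
theorem IsRun.integral_stationarity_le [MeasurableSpace Ω] {P : Measure Ω}
    [IsProbabilityMeasure P] [IsProbabilityMeasure μ] {τ : Ω → Fin T}
    (h : IsRun l r K ν S η x₁ x) (hS : IsSampling P μ S τ) (hd : 2 ≤ d) (hm : 0 < m) (hT : 0 < T)
    (hν : 0 < ν) (hK : MirrorDomain r K D) {G L : ℝ} (hl : SmoothLoss l G L)
    (hu : UnbiasedGradient l μ) (hpos : ∀ t ω, 0 < η t ω)
    (hη : ∀ t < T, ∀ m₀ : MeasurableSpace Ω, (∀ s ≤ t, Measurable[m₀] (x s)) →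
      Measurable[m₀] (η t)) {W A c : ℝ} (hW0 : 0 ≤ W) (hc : 0 ≤ c)
    (hW : 8 * G ^ 2 * (Real.log (2 * d) + 1) / m + (L * ν * d) ^ 2 / 2 ≤ W)
    (hpath : ∀ ω, ∑ t ∈ Finset.range T, iterateStationarity l μ r K D η x t ω ≤
      A + c * ∑ t ∈ Finset.range T, estimationError l μ ν S x t ω ^ 2) :
    Integrable (stationarity l μ r K D η x τ) P ∧
      ∫ ω, stationarity l μ r K D η x τ ω ∂P ≤ A / T + c * W := by
  have hd0 : 0 < d := by omega
  have hT' : (0 : ℝ) < T := by exact_mod_cast hT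
  have hxm : ∀ t ≤ T, Measurable[pastSigma S t] (x t) := fun t ht =>
    h.measurable hd0 hK hl hu.measurable hpos hη ht
  have herr : ∀ t ∈ Finset.range T,
      Integrable (fun ω => estimationError l μ ν S x t ω ^ 2) P ∧
      ∫ ω, estimationError l μ ν S x t ω ^ 2 ∂P ≤ W := by
    intro t ht
    have ht := Finset.mem_range.1 ht
    have := hS.integral_supNorm_error_le hl hu hd hm hν ⟨t, ht⟩ (hxm t ht.le) hW0 hW
    simpa only [estimationError, dif_pos ht] using this
  set Z : ℕ → Ω → ℝ := iterateStationarity l μ r K D η x with hZ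
  have hZm : ∀ t < T, Measurable[pastSigma S T] (Z t) := by
    intro t ht
    have hx : ∀ s ≤ t, Measurable[pastSigma S T] (x s) := fun s hs =>
      (hxm s (by omega)).mono (pastSigma_mono (by omega)) le_rfl
    exact measurable_iterateStationarity (mΩ := pastSigma S T) hd0 hK hl hu (hx t le_rfl)
      (hη t ht _ hx) (hpos t)
  have hZ0 : ∀ t ω, 0 ≤ Z t ω := fun t ω => sq_nonneg _
  set U : Ω → ℝ := fun ω => A + c * ∑ t ∈ Finset.range T, estimationError l μ ν S x t ω ^ 2 with hU
  have hUint : Integrable U P := (integrable_const A).add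
    ((integrable_finsetSum _ fun t ht => (herr t ht).1).const_mul c)
  have hZint : ∀ t < T, Integrable (Z t) P := by
    intro t ht
    refine hUint.mono' ((hZm t ht).mono (hS.pastSigma_le T) le_rfl).aestronglyMeasurable
      (Filter.Eventually.of_forall fun ω => ?_)
    rw [Real.norm_of_nonneg (hZ0 t ω)]
    exact (Finset.single_le_sum (f := fun t => Z t ω) (fun s _ => hZ0 s ω)
      (Finset.mem_range.2 ht)).trans (hpath ω)
  rw [stationarity_eq_iterateStationarity hd0 hK.nonneg]
  obtain ⟨h1, h2⟩ := hS.integral_index (Z := fun t => Z t) (fun t => hZm t t.2)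
    (fun t => hZint t t.2)
  refine ⟨h1, h2.trans_le ?_⟩
  rw [div_le_iff₀ hT', Fin.sum_univ_eq_sum_range (fun t => ∫ ω, Z t ω ∂P),
    ← integral_finsetSum _ fun t ht => hZint t (Finset.mem_range.1 ht)]
  calc _ ≤ ∫ ω, U ω ∂P := integral_mono
        (integrable_finsetSum _ fun t ht => hZint t (Finset.mem_range.1 ht)) hUint hpath
    _ = A + c * ∑ t ∈ Finset.range T, ∫ ω, estimationError l μ ν S x t ω ^ 2 ∂P := by
        rw [hU, integral_add (integrable_const A)
          ((integrable_finsetSum _ fun t ht => (herr t ht).1).const_mul c), integral_const_mul,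
          integral_finsetSum _ fun t ht => (herr t ht).1]
        simp
    _ ≤ A + c * ∑ _t ∈ Finset.range T, W := by
        gcongr with t ht
        exact (herr t ht).2
    _ = _ := by
        simp only [Finset.sum_const, Finset.card_range, nsmul_eq_mul]
        field_simp

/-- The descent inequality and the bound on the gradient map for one iteration of a run. -/
lemma IsRun.step_bounds [IsProbabilityMeasure μ] (h : IsRun l r K ν S η x₁ x) (hd : 0 < d)
    (hK : MirrorDomain r K D) (hx₁ : x₁ ∈ K) {G L : ℝ} (hL : 0 ≤ L) (hl : SmoothLoss l G L)
    (hu : UnbiasedGradient l μ) (hpos : ∀ t ω, 0 < η t ω) {t : ℕ} (ht : t < T) (ω : Ω) :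
    η t ω * (l1Norm (x (t + 1) ω - x t ω) ^ 2 / (D + 1)) ≤
        (meanLoss l μ (x t ω) + r (x t ω)) - (meanLoss l μ (x (t + 1) ω) + r (x (t + 1) ω)) +
        estimationError l μ ν S x t ω * l1Norm (x (t + 1) ω - x t ω) +
        L / 2 * l1Norm (x (t + 1) ω - x t ω) ^ 2 ∧
      ∃ g, 0 ≤ g ∧ iterateStationarity l μ r K D η x t ω = g ^ 2 ∧
        g ≤ η t ω / (D + 1) * l1Norm (x (t + 1) ω - x t ω) + estimationError l μ ν S x t ω := by
  have hmin := h.isMirrorMin hd hK ⟨t, ht⟩ ω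
  have hF : ∀ y, HasGradientAt (meanLoss l μ) (gradient (meanLoss l μ) y) y := fun y => by
    rw [(hu.unbiased y).gradient]
    exact hu.unbiased y
  simp only [estimationError, dif_pos ht]
  refine ⟨hmin.descent hd hK.convex hK.convexOn hK.l1Norm_le hF
    (hl.norm_gradient_meanLoss_sub_le hd hu) hL (hpos t ω).le (h.mem hd hK hx₁ ht.le ω),
    _, l1Norm_nonneg _, rfl, ?_⟩
  exact l1Norm_smul_sub_le hd hK.convex hK.convexOn hK.nonneg hK.l1Norm_le (hpos t ω).le hmin
    (isMirrorMin_genProj hd hK.isCompact hK.nonempty hK.continuous _ _ _)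

lemma IsRun.sum_iterateStationarity_le_of_const [IsProbabilityMeasure μ]
    (h : IsRun l r K ν S η x₁ x) (hd : 0 < d) (hK : MirrorDomain r K D) (hx₁ : x₁ ∈ K) {G L R : ℝ}
    (hL : 0 < L) (hl : SmoothLoss l G L) (hu : UnbiasedGradient l μ)
    (hvalue : ∀ x ∈ K, meanLoss l μ x + r x ∈ Set.Icc 0 R)
    (hη : ∀ t ω, η t ω = 2 * L * (D + 1)) (ω : Ω) :
    ∑ t ∈ Finset.range T, iterateStationarity l μ r K D η x t ω ≤
      6 * L * R + 6 * ∑ t ∈ Finset.range T, estimationError l μ ν S x t ω ^ 2 := by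
  have hD := hK.nonneg
  have hpos : ∀ t ω, 0 < η t ω := fun t ω => by
    rw [hη]
    positivity
  set f : ℕ → ℝ := fun t => meanLoss l μ (x t ω) + r (x t ω) with hf
  have hfmem : ∀ t ≤ T, f t ∈ Set.Icc 0 R := fun t ht => hvalue _ (h.mem hd hK hx₁ ht ω)
  calc _ ≤ ∑ t ∈ Finset.range T,
        (6 * L * (f t - f (t + 1)) + 6 * estimationError l μ ν S x t ω ^ 2) := by
        refine Finset.sum_le_sum fun t ht => ?_
        obtain ⟨h1, g, hg0, hg, h2⟩ :=
          h.step_bounds hd hK hx₁ hL.le hl hu hpos (Finset.mem_range.1 ht) ω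
        rw [hg]
        rw [hη] at h1 h2
        refine sq_le_of_descent_of_const_step hL hg0 (δ := l1Norm (x (t + 1) ω - x t ω)) ?_ ?_
        · rwa [show 2 * L * (D + 1) * (l1Norm (x (t + 1) ω - x t ω) ^ 2 / (D + 1)) =
            2 * L * l1Norm (x (t + 1) ω - x t ω) ^ 2 by field_simp] at h1
        · rwa [show 2 * L * (D + 1) / (D + 1) = 2 * L by field_simp] at h2
    _ = 6 * L * (f 0 - f T) + 6 * ∑ t ∈ Finset.range T, estimationError l μ ν S x t ω ^ 2 := by
        rw [Finset.sum_add_distrib, ← Finset.mul_sum, ← Finset.mul_sum, Finset.sum_range_sub']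
    _ ≤ _ := by
        gcongr
        linarith [(hfmem 0 (Nat.zero_le _)).2, (hfmem T le_rfl).1]

lemma IsRun.sum_iterateStationarity_le_of_adaptive [IsProbabilityMeasure μ]
    (h : IsRun l r K ν S η x₁ x) (hd : 0 < d) (hK : MirrorDomain r K D) (hx₁ : x₁ ∈ K) {G L R : ℝ}
    (hL : 0 < L) (hR : 0 < R) (hl : SmoothLoss l G L) (hu : UnbiasedGradient l μ)
    (hvalue : ∀ x ∈ K, meanLoss l μ x + r x ∈ Set.Icc 0 R) (hD : 1 ≤ D) (hR2 : 1 / 2 ≤ R ^ 2)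
    (hη : ∀ t ω, η t ω = adaptiveStep (fun s => x s ω) t) (ω : Ω) :
    ∑ t ∈ Finset.range T, iterateStationarity l μ r K D η x t ω ≤
      (16 * R ^ 2 + 64 * L ^ 2 * D * (D + 1)) +
        10 * ∑ t ∈ Finset.range T, estimationError l μ ν S x t ω ^ 2 := by
  have hD0 := hK.nonneg
  have hpos : ∀ t ω, 0 < η t ω := fun t ω => by
    rw [hη]
    exact adaptiveStep_pos _ t
  set X : ℕ → EuclideanSpace ℝ (Fin d) := fun s => x s ω with hX
  have hXD : ∀ t ≤ T, l1Norm (X t) ≤ D := fun t ht => hK.l1Norm_le _ (h.mem hd hK hx₁ ht ω)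
  set δ : ℕ → ℝ := fun t => l1Norm (X (t + 1) - X t) with hδ
  set e : ℕ → ℝ := fun t => estimationError l μ ν S x t ω with he
  have hstep := fun t (ht : t < T) => h.step_bounds hd hK hx₁ hL.le hl hu hpos ht ω
  simp only [hη] at hstep
  have hH := sum_sq_le_of_adaptive_descent (α := adaptiveStep X)
    (f := fun t => meanLoss l μ (X t) + r (X t)) (h := fun t => adaptiveStep X t / (D + 1) * δ t)
    (δ := δ) (e := e) (T := T) hL.le hD hR hR2 (fun t _ => adaptiveStep_pos X t)
    (fun t _ => adaptiveStep_le_succ X t) (fun t ht => hvalue _ (h.mem hd hK hx₁ ht ω))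
    (fun t _ => l1Norm_nonneg _) (fun t ht => ?_) (fun t _ => rfl)
    (fun t ht => one_add_sum_le_adaptiveStep_sq hD0 fun s hs => hXD s (hs.trans ht))
    (adaptiveStep_sq_le hD0 T) (fun t ht => (hstep t ht).1)
  · calc _ ≤ ∑ t ∈ Finset.range T,
          (2 * (adaptiveStep X t / (D + 1) * δ t) ^ 2 + 2 * e t ^ 2) := by
          refine Finset.sum_le_sum fun t ht => ?_
          obtain ⟨-, g, hg0, hg, h2⟩ := hstep t (Finset.mem_range.1 ht)
          rw [hg]
          calc g ^ 2 ≤ (adaptiveStep X t / (D + 1) * δ t + e t) ^ 2 := by gcongr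
            _ ≤ 2 * ((adaptiveStep X t / (D + 1) * δ t) ^ 2 + e t ^ 2) := add_sq_le
            _ = _ := by ring
      _ = 2 * ∑ t ∈ Finset.range T, (adaptiveStep X t / (D + 1) * δ t) ^ 2 +
          2 * ∑ t ∈ Finset.range T, e t ^ 2 := by
          rw [Finset.sum_add_distrib, ← Finset.mul_sum, ← Finset.mul_sum]
      _ ≤ _ := by linarith
  · have h1 := l1Norm_sub_le (X (t + 1)) (X t)
    have h2 := hXD t ht.le
    have h3 := hXD (t + 1) ht
    simp only [hδ]
    linarith

end Run

/-! ### Parameters -/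

/-- The relations between `m`, `T` and `κ = √(2e(2 ln d - 1) / (mT))` that follow from
`m = ⌈2Te(2 ln d - 1)⌉`: up to a constant factor, `κ` is `1 / T`. -/
lemma batchSize_bounds {d T m : ℕ} (hd : 3 ≤ d) (hT : 1 ≤ T)
    (hm : m = ⌈2 * (T : ℝ) * Real.exp 1 * (2 * Real.log d - 1)⌉₊) :
    0 < m ∧ Real.log (2 * d) + 1 ≤ Real.exp 1 * (2 * Real.log d - 1) ∧
    2 * Real.exp 1 * (2 * Real.log d - 1) / m ≤
      Real.sqrt (2 * Real.exp 1 * (2 * Real.log d - 1) / ((m : ℝ) * T)) ∧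
    Real.sqrt (2 * Real.exp 1 * (2 * Real.log d - 1) / ((m : ℝ) * T)) ≤ 1 / T ∧
    1 / (T : ℝ) ≤ 9 / 8 *
      Real.sqrt (2 * Real.exp 1 * (2 * Real.log d - 1) / ((m : ℝ) * T)) ∧
    2 * (m : ℝ) * T ≤ 8 * Real.exp 1 * Real.log d * T ^ 2 := by
  have hd' : (3 : ℝ) ≤ d := by exact_mod_cast hd
  have hT' : (1 : ℝ) ≤ T := by exact_mod_cast hT
  have he1 := Real.exp_one_gt_d9
  have he2 := Real.exp_one_lt_d9
  have hlog : 1 ≤ Real.log d := by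
    rw [Real.le_log_iff_exp_le (by linarith)]
    linarith
  set w := Real.log d with hw
  set a := 2 * Real.exp 1 * (2 * w - 1) with ha
  have ha5 : 5 ≤ a := by
    rw [ha]
    nlinarith
  have haT : 2 * (T : ℝ) * Real.exp 1 * (2 * w - 1) = a * T := by
    rw [ha]
    ring
  rw [haT] at hm
  have hm1 : a * T ≤ m := by
    rw [hm]
    exact Nat.le_ceil _
  have hm2 : (m : ℝ) ≤ a * T + 1 := by
    rw [hm]
    exact (Nat.ceil_lt_add_one (by positivity)).le
  have haT5 : 5 ≤ a * T := by nlinarith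
  have hmpos : (0 : ℝ) < m := by linarith
  refine ⟨by exact_mod_cast hmpos, ?_, ?_, ?_, ?_, ?_⟩
  · rw [Real.log_mul (by norm_num) (by linarith), ← hw]
    have := Real.log_two_lt_d9
    nlinarith
  · refine Real.le_sqrt_of_sq_le ?_
    rw [div_pow, div_le_div_iff₀ (by positivity) (by positivity)]
    have := mul_le_mul_of_nonneg_left hm1 (by positivity : 0 ≤ a * m)
    nlinarith
  · refine Real.sqrt_le_iff.2 ⟨by positivity, ?_⟩
    rw [div_pow, one_pow, div_le_div_iff₀ (by positivity) (by positivity)]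
    nlinarith
  · have h : 8 / 9 * (1 / (T : ℝ)) ≤ Real.sqrt (a / (m * T)) := by
      refine Real.le_sqrt_of_sq_le ?_
      rw [show (8 / 9 * (1 / (T : ℝ))) ^ 2 = 64 / (81 * T ^ 2) by field_simp; norm_num,
        div_le_div_iff₀ (by positivity) (by positivity)]
      nlinarith
    linarith
  · have h1 : (T : ℝ) ≤ T ^ 2 := by nlinarith
    have h2 : 2 * (m : ℝ) * T ≤ 2 * (a * T + 1) * T := by gcongr
    have h3 : 2 * (a * T + 1) * T = 8 * Real.exp 1 * w * T ^ 2 -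
        (4 * Real.exp 1 * T ^ 2 - 2 * T) := by
      rw [ha]
      ring
    nlinarith

/-- The accuracy and the number `N` of oracle calls after `T = ⌈B / ε²⌉` iterations; `w` stands for
`ln d`. -/
lemma complexity_bounds {T : ℕ} {B κ ε w N : ℝ} (hB : 0 ≤ B) (hT : 1 ≤ T) (hw : 0 ≤ w)
    (hκ : κ ≤ 1 / T) (hN : N ≤ 8 * Real.exp 1 * w * T ^ 2) (hε : 0 < ε) (hε1 : ε ≤ 1)
    (hTB : T = ⌈B / ε ^ 2⌉₊) :
    κ * B ≤ ε ^ 2 ∧ N ≤ 8 * Real.exp 1 * (B + 1) ^ 2 * (w / ε ^ 4) := by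
  have hT' : (0 : ℝ) < T := by exact_mod_cast hT
  have h1 : B / ε ^ 2 ≤ T := by
    rw [hTB]
    exact Nat.le_ceil _
  have h2 : (T : ℝ) ≤ (B + 1) / ε ^ 2 := by
    have h3 : (T : ℝ) ≤ B / ε ^ 2 + 1 := by
      rw [hTB]
      exact (Nat.ceil_lt_add_one (by positivity)).le
    have h4 : 1 ≤ 1 / ε ^ 2 := by
      rw [le_div_iff₀ (by positivity), one_mul]
      exact pow_le_one₀ hε.le hε1
    rw [add_div]
    linarith
  constructor
  · calc κ * B ≤ 1 / T * B := by gcongr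
      _ = B / T := by ring
      _ ≤ ε ^ 2 := by
        rw [div_le_iff₀ hT']
        rw [div_le_iff₀ (by positivity)] at h1
        linarith
  · calc N ≤ 8 * Real.exp 1 * w * T ^ 2 := hN
      _ ≤ 8 * Real.exp 1 * w * ((B + 1) / ε ^ 2) ^ 2 := by gcongr
      _ = _ := by
        field_simp

end ZOAdaExp

end

theorem mainTheorem2
    {d T m : ℕ} (hd : 3 ≤ d) (hT : 1 ≤ T)
    {Ω Ξ : Type*} [MeasurableSpace Ω] [MeasurableSpace Ξ]
    (P : Measure Ω) [IsProbabilityMeasure P] (μ : Measure Ξ) [IsProbabilityMeasure μ]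
    -- the composite problem
    (l : EuclideanSpace ℝ (Fin d) → Ξ → ℝ) (r : EuclideanSpace ℝ (Fin d) → ℝ)
    (K : Set (EuclideanSpace ℝ (Fin d))) (hK : IsClosed K) (hKconv : Convex ℝ K)
    (hr : ConvexOn ℝ Set.univ r)
    (G L σ D R : ℝ) (hL : 0 < L) (hD : 0 < D) (hR : 0 < R)
    (hsmooth : ZOAdaExp.SmoothLoss l G L)
    (hunbiased : ZOAdaExp.UnbiasedGradient l μ)
    (hvar : ∀ x ∈ K, ∫ ξ, ‖gradient (ZOAdaExp.meanLoss l μ) x -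
      gradient (fun z => l z ξ) x‖ ^ 2 ∂μ ≤ σ ^ 2)
    (hcompact : ∀ η : ℝ, 0 < η → ∀ x ∈ K, ∀ g : EuclideanSpace ℝ (Fin d),
      ZOAdaExp.l1Norm (ZOAdaExp.genProj ZOAdaExp.entropyLike r K x g η) ≤ D)
    (hvalue : ∀ x ∈ K, ZOAdaExp.meanLoss l μ x + r x ∈ Set.Icc 0 R)
    -- the parameters and the randomness of the algorithm
    (hm : m = ⌈2 * (T : ℝ) * Real.exp 1 * (2 * Real.log d - 1)⌉₊)
    (ν : ℝ) (hν : ν = 1 / ((d : ℝ) * Real.sqrt T))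
    (S : Fin T → Fin m → Ω → (Fin d → ℝ) × Ξ) (τ : Ω → Fin T)
    (hS : ZOAdaExp.IsSampling P μ S τ)
    (x₁ : EuclideanSpace ℝ (Fin d)) (hx₁ : x₁ ∈ K)
    (V : ℝ) (hV : V = 10 * G ^ 2 + 8 * σ ^ 2 + 2 * L ^ 2)
    (C : ℝ) (hC : C = 33 * R ^ 2 + 192 * L ^ 2 * D * (D + 1)) :
    -- constant stepsizes
    (∀ (η : ℕ → Ω → ℝ) (x : ℕ → Ω → EuclideanSpace ℝ (Fin d)),
      (∀ t ω, η t ω = 2 * L * (D + 1)) →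
      ZOAdaExp.IsRun l r K ν S η x₁ x →
        Integrable (ZOAdaExp.stationarity l μ r K D η x τ) P ∧
        ∫ ω, ZOAdaExp.stationarity l μ r K D η x τ ω ∂P ≤
          Real.sqrt (2 * Real.exp 1 * (2 * Real.log d - 1) / ((m : ℝ) * T)) *
            (6 * V + 8 * L * R) ∧
        ∀ ε : ℝ, 0 < ε → ε ≤ 1 → T = ⌈(6 * V + 8 * L * R) / ε ^ 2⌉₊ →
          ∫ ω, ZOAdaExp.stationarity l μ r K D η x τ ω ∂P ≤ ε ^ 2 ∧
          ∀ ω, (ZOAdaExp.oracleCalls ν S x ω : ℝ) ≤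
            8 * Real.exp 1 * (6 * V + 8 * L * R + 1) ^ 2 * (Real.log d / ε ^ 4)) ∧
    -- adaptive stepsizes
    (1 ≤ D → 1 / 2 ≤ R ^ 2 →
      ∀ (η : ℕ → Ω → ℝ) (x : ℕ → Ω → EuclideanSpace ℝ (Fin d)),
      (∀ t ω, η t ω = ZOAdaExp.adaptiveStep (fun s => x s ω) t) →
      ZOAdaExp.IsRun l r K ν S η x₁ x →
        Integrable (ZOAdaExp.stationarity l μ r K D η x τ) P ∧
        ∫ ω, ZOAdaExp.stationarity l μ r K D η x τ ω ∂P ≤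
          Real.sqrt (2 * Real.exp 1 * (2 * Real.log d - 1) / ((m : ℝ) * T)) *
            (13 * V + C) ∧
        ∀ ε : ℝ, 0 < ε → ε ≤ 1 → T = ⌈(13 * V + C) / ε ^ 2⌉₊ →
          ∫ ω, ZOAdaExp.stationarity l μ r K D η x τ ω ∂P ≤ ε ^ 2 ∧
          ∀ ω, (ZOAdaExp.oracleCalls ν S x ω : ℝ) ≤
            8 * Real.exp 1 * (13 * V + C + 1) ^ 2 * (Real.log d / ε ^ 4)) := by
  have hd0 : 0 < d := by omega
  have hT' : (0 : ℝ) < T := by exact_mod_cast hT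
  have hd' : (0 : ℝ) < d := by exact_mod_cast hd0
  obtain ⟨hmpos, hlog, hκ₁, hκ₂, hκ₃, hcalls⟩ := ZOAdaExp.batchSize_bounds hd hT hm
  set κ := Real.sqrt (2 * Real.exp 1 * (2 * Real.log d - 1) / ((m : ℝ) * T)) with hκ
  have hm' : (0 : ℝ) < m := by exact_mod_cast hmpos
  have hκ0 : 0 ≤ κ := Real.sqrt_nonneg _
  have hw0 : 0 ≤ Real.log d := Real.log_nonneg (by exact_mod_cast hd0)
  have hKD : ∀ x ∈ K, ZOAdaExp.l1Norm x ≤ D := fun x hx =>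
    ZOAdaExp.l1Norm_le_of_genProj hd0 hKconv hr hr.locallyLipschitz.continuous hcompact hx
  have hdom : ZOAdaExp.MirrorDomain r K D :=
    ⟨⟨x₁, hx₁⟩, ZOAdaExp.isCompact_of_l1Norm_le hK hKD, hKconv, hr, hKD⟩
  have hνpos : 0 < ν := by
    rw [hν]
    positivity
  -- the mean squared error of the gradient estimates in terms of `κ`
  have hW : 8 * G ^ 2 * (Real.log (2 * d) + 1) / m + (L * ν * d) ^ 2 / 2 ≤
      κ * (4 * G ^ 2 + 9 / 16 * L ^ 2) := by
    have h1 : 8 * G ^ 2 * (Real.log (2 * d) + 1) / m ≤ κ * (4 * G ^ 2) := by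
      calc _ ≤ 8 * G ^ 2 * (Real.exp 1 * (2 * Real.log d - 1)) / m := by gcongr
        _ = 2 * Real.exp 1 * (2 * Real.log d - 1) / m * (4 * G ^ 2) := by ring
        _ ≤ _ := by gcongr
    have h2 : (L * ν * d) ^ 2 / 2 = 1 / T * (L ^ 2 / 2) := by
      rw [hν, show L * (1 / ((d : ℝ) * Real.sqrt T)) * d = L / Real.sqrt T by field_simp, div_pow,
        Real.sq_sqrt hT'.le]
      ring
    have h3 : 1 / (T : ℝ) * (L ^ 2 / 2) ≤ 9 / 8 * κ * (L ^ 2 / 2) := by gcongr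
    linarith
  have hW0 : 0 ≤ κ * (4 * G ^ 2 + 9 / 16 * L ^ 2) := by positivity
  have hV0 : 0 ≤ V := by
    rw [hV]
    positivity
  have hN : ∀ (x : ℕ → Ω → EuclideanSpace ℝ (Fin d)) (ω : Ω),
      (ZOAdaExp.oracleCalls ν S x ω : ℝ) ≤ 8 * Real.exp 1 * Real.log d * T ^ 2 := by
    intro x ω
    rw [ZOAdaExp.oracleCalls_eq]
    push_cast
    linarith
  have hκG : 0 ≤ κ * G ^ 2 := by positivity
  have hκL : 0 ≤ κ * L ^ 2 := by positivity
  have hκσ : 0 ≤ κ * σ ^ 2 := by positivity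
  constructor
  · intro η x hη hrun
    have hpos : ∀ t ω, 0 < η t ω := fun t ω => by
      rw [hη]
      positivity
    obtain ⟨hint, hle⟩ := hrun.integral_stationarity_le hS (by omega) hmpos hT hνpos hdom hsmooth
      hunbiased hpos (fun t _ m₀ _ => by
        rw [show η t = fun _ => 2 * L * (D + 1) from funext (hη t)]
        exact measurable_const) hW0 (by norm_num) hW
      (hrun.sum_iterateStationarity_le_of_const hd0 hdom hx₁ hL hsmooth hunbiased hvalue hη)
    have hB0 : 0 ≤ 6 * V + 8 * L * R := by positivity
    have hmain : ∫ ω, ZOAdaExp.stationarity l μ r K D η x τ ω ∂P ≤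
        κ * (6 * V + 8 * L * R) := by
      refine hle.trans ?_
      have h1 : 6 * L * R / T ≤ 9 / 8 * κ * (6 * L * R) := by
        rw [div_eq_mul_one_div, mul_comm]
        gcongr
      have h2 : 0 ≤ κ * (L * R) := by positivity
      rw [hV]
      linarith
    refine ⟨hint, hmain, fun ε hε hε1 hTε => ?_⟩
    have hbounds := fun ω => ZOAdaExp.complexity_bounds hB0 hT hw0 hκ₂ (hN x ω) hε hε1 hTε
    obtain ⟨ω₀⟩ := P.nonempty_of_neZero
    exact ⟨hmain.trans (hbounds ω₀).1, fun ω => (hbounds ω).2⟩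
  · intro hD1 hR2 η x hη hrun
    have hpos : ∀ t ω, 0 < η t ω := fun t ω => by
      rw [hη]
      exact ZOAdaExp.adaptiveStep_pos _ t
    obtain ⟨hint, hle⟩ := hrun.integral_stationarity_le hS (by omega) hmpos hT hνpos hdom hsmooth
      hunbiased hpos (fun t _ m₀ hx => by
        rw [show η t = _ from funext (hη t)]
        exact ZOAdaExp.measurable_adaptiveStep t hx) hW0 (by norm_num) hW
      (hrun.sum_iterateStationarity_le_of_adaptive hd0 hdom hx₁ hL hR hsmooth hunbiased hvalue
        hD1 hR2 hη)
    have hB0 : 0 ≤ 13 * V + C := by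
      rw [hC]
      positivity
    have hmain : ∫ ω, ZOAdaExp.stationarity l μ r K D η x τ ω ∂P ≤ κ * (13 * V + C) := by
      refine hle.trans ?_
      have h1 : (16 * R ^ 2 + 64 * L ^ 2 * D * (D + 1)) / T ≤
          9 / 8 * κ * (16 * R ^ 2 + 64 * L ^ 2 * D * (D + 1)) := by
        rw [div_eq_mul_one_div, mul_comm]
        gcongr
      have h2 : 0 ≤ κ * R ^ 2 := by positivity
      have h3 : 0 ≤ κ * (L ^ 2 * D * (D + 1)) := by positivity
      rw [hV, hC]
      linarith
    refine ⟨hint, hmain, fun ε hε hε1 hTε => ?_⟩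
    have hbounds := fun ω => ZOAdaExp.complexity_bounds hB0 hT hw0 hκ₂ (hN x ω) hε hε1 hTε
    obtain ⟨ω₀⟩ := P.nonempty_of_neZero
    exact ⟨hmain.trans (hbounds ω₀).1, fun ω => (hbounds ω).2⟩
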